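/- Let $\Bbbk$ be an algebraically closed field of characteristic $p>2$. Let $G$ be one of the groups $\mathrm{GL}_n(\Bbbk)$, $\mathrm{SL}_n(\Bbbk)$, $\mathrm{Sp}_n(\Bbbk)$ (with $n$ even), $\mathrm{O}_n(\Bbbk)$ or $\mathrm{SO}_n(\Bbbk)$, acting by conjugation on its Lie algebra $\mathfrak g=\operatorname{Lie}(G)$, which is $\mathfrak{gl}_n(\Bbbk)$, $\mathfrak{sl}_n(\Bbbk)$, $\mathfrak{sp}_n(\Bbbk)$, $\mathfrak{so}_n(\Bbbk)$ or $\mathfrak{so}_n(\Bbbk)$ respectively, and let $\mathcal N$ be the set of nilpotent elements of $\mathfrak g$. An $\mathfrak{sl}_2$-triple in $\mathfrak g$ is a triple $(e,h,f)$ of elements of $\mathfrak g$ such that $[h,e]=2e$, $[h,f]=-2f$ and $[e,f]=h$. A $G$-stable Zariski closed subset (not necessarily irreducible) $\mathcal V\subseteq\mathcal N$ is said to satisfy the $\mathfrak{sl}_2$-property if the map $$\{G\text{-orbits of }\mathfrak{sl}_2\text{-triples }(e,h,f)\text{ in }\mathfrak g\text{ with }e,f\in\mathcal V\}\longrightarrow\{G\text{-orbits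 in }\mathcal V\}$$ sending the $G$-orbit of $(e,h,f)$ to the $G$-orbit of $e$ is a bijection. If $\mathcal V\subseteq\mathcal N$ is a $G$-stable closed subvariety that satisfies the $\mathfrak{sl}_2$-property, then $\mathcal V\subseteq\mathcal N^p:=\{x\in\mathfrak g\mid x^p=0\}$. -/

import Mathlib

open Matrix

namespace ClassicalSl2

section Groups

variable (ι : Type*) [Fintype ι] [DecidableEq ι] (k : Type*) [CommRing k]

/-- `SL` as a subgroup of `GL`: the invertible matrices of determinant one. -/
def SLgroup : Subgroup (GL ι k) :=
  (Matrix.GeneralLinearGroup.det : GL ι k →* kˣ).ker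

/-- `O` as a subgroup of `GL`: the invertible matrices `g` with `gᵀ * g = 1`. -/
def Ogroup : Subgroup (GL ι k) :=
  (Matrix.orthogonalGroup ι k).units

/-- `SO` as a subgroup of `GL`: the orthogonal matrices of determinant one. -/
def SOgroup : Subgroup (GL ι k) :=
  Ogroup ι k ⊓ SLgroup ι k

/-- `Sp` as a subgroup of `GL`: the invertible matrices `g` with `g * J * gᵀ = J`, where `J` is
the standard alternating matrix of size `2 * card ι`. -/
def Spgroup : Subgroup (GL (ι ⊕ ι) k) :=
  (Matrix.symplecticGroup ι k).units

theorem mem_SLgroup_iff (g : GL ι k) : g ∈ SLgroup ι k ↔ (g : Matrix ι ι k).det = 1 := by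
  rw [SLgroup, MonoidHom.mem_ker, Units.ext_iff]
  rfl

theorem mem_Ogroup_iff (g : GL ι k) :
    g ∈ Ogroup ι k ↔ (g : Matrix ι ι k)ᵀ * (g : Matrix ι ι k) = 1 := by
  have key : ∀ A : Matrix ι ι k, A ∈ Matrix.orthogonalGroup ι k ↔ Aᵀ * A = 1 :=
    fun A => Matrix.mem_orthogonalGroup_iff' ι k
  rw [Ogroup, Submonoid.mem_units_iff, key, key]
  refine ⟨fun h => h.1, fun h => ⟨h, ?_⟩⟩
  have h1 : ((g⁻¹ : GL ι k) : Matrix ι ι k) = (g : Matrix ι ι k)ᵀ :=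
    (left_inv_eq_right_inv h (Units.mul_inv g)).symm
  rw [h1, Matrix.transpose_transpose, ← h1]
  exact Units.mul_inv g

theorem mem_Spgroup_iff (g : GL (ι ⊕ ι) k) :
    g ∈ Spgroup ι k ↔
      (g : Matrix (ι ⊕ ι) (ι ⊕ ι) k) * Matrix.J ι k * (g : Matrix (ι ⊕ ι) (ι ⊕ ι) k)ᵀ
        = Matrix.J ι k := by
  rw [Spgroup, Submonoid.mem_units_iff, SymplecticGroup.mem_iff, SymplecticGroup.mem_iff]
  refine ⟨fun h => h.1, fun h => ⟨h, ?_⟩⟩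
  have h1 : ((g⁻¹ : GL (ι ⊕ ι) k) : Matrix (ι ⊕ ι) (ι ⊕ ι) k) * g = 1 := Units.inv_mul g
  have h2 : (g : Matrix (ι ⊕ ι) (ι ⊕ ι) k)ᵀ *
      ((g⁻¹ : GL (ι ⊕ ι) k) : Matrix (ι ⊕ ι) (ι ⊕ ι) k)ᵀ = 1 := by
    rw [← Matrix.transpose_mul, h1, Matrix.transpose_one]
  set a := ((g⁻¹ : GL (ι ⊕ ι) k) : Matrix (ι ⊕ ι) (ι ⊕ ι) k)
  set b := (g : Matrix (ι ⊕ ι) (ι ⊕ ι) k)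
  calc a * Matrix.J ι k * aᵀ = a * (b * Matrix.J ι k * bᵀ) * aᵀ := by rw [h]
    _ = (a * b) * Matrix.J ι k * (bᵀ * aᵀ) := by simp only [Matrix.mul_assoc]
    _ = Matrix.J ι k := by rw [h1, h2, Matrix.one_mul, Matrix.mul_one]

end Groups

section Sl2Property

attribute [local instance 100] LieRing.ofAssociativeRing

variable {ι : Type*} [Fintype ι] [DecidableEq ι] {k : Type*} [Field k]

/-- The adjoint action of a matrix group: `Ad g x = g x g⁻¹`. -/
def Ad (g : GL ι k) (x : Matrix ι ι k) : Matrix ι ι k :=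
  (g : Matrix ι ι k) * x * ((g⁻¹ : GL ι k) : Matrix ι ι k)

/-- The `G`-orbit of a matrix under the adjoint action. -/
def orbit (G : Subgroup (GL ι k)) (x : Matrix ι ι k) : Set (Matrix ι ι k) :=
  {y | ∃ g ∈ G, y = Ad g x}

/-- The `G`-orbit of a triple of matrices under the simultaneous adjoint action. -/
def tripleOrbit (G : Subgroup (GL ι k)) (t : Matrix ι ι k × Matrix ι ι k × Matrix ι ι k) :
    Set (Matrix ι ι k × Matrix ι ι k × Matrix ι ι k) :=
  {s | ∃ g ∈ G, s = (Ad g t.1, Ad g t.2.1, Ad g t.2.2)}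

/-- `t = (e, h, f)` is an `𝔰𝔩₂`-triple in the Lie algebra `𝔤` of matrices. The zero triple is
allowed: an `𝔰𝔩₂`-triple is the image of the standard basis under any homomorphism `𝔰𝔩₂ → 𝔤`. -/
def IsTriple (𝔤 : LieSubalgebra k (Matrix ι ι k))
    (t : Matrix ι ι k × Matrix ι ι k × Matrix ι ι k) : Prop :=
  (t.1 ∈ 𝔤 ∧ t.2.1 ∈ 𝔤 ∧ t.2.2 ∈ 𝔤) ∧
    ⁅t.2.1, t.1⁆ = (2 : k) • t.1 ∧ ⁅t.2.1, t.2.2⁆ = (-2 : k) • t.2.2 ∧ ⁅t.1, t.2.2⁆ = t.2.1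

/-- The nilpotent cone of `𝔤`. -/
def nilpotentCone (𝔤 : LieSubalgebra k (Matrix ι ι k)) : Set (Matrix ι ι k) :=
  {x | x ∈ 𝔤 ∧ IsNilpotent x}

/-- The restricted nilpotent cone of `𝔤`; the `p`-power map of a Lie algebra of a classical
group is the `p`-th power of matrices. -/
def restrictedNilpotentCone (𝔤 : LieSubalgebra k (Matrix ι ι k)) (p : ℕ) :
    Set (Matrix ι ι k) :=
  {x | x ∈ 𝔤 ∧ x ^ p = 0}

/-- Zariski closed subsets of the affine space of matrices: common zero sets of polynomials in
the matrix entries. -/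
def IsZariskiClosed (V : Set (Matrix ι ι k)) : Prop :=
  ∃ S : Set (MvPolynomial (ι × ι) k),
    V = {x | ∀ P ∈ S, MvPolynomial.eval (fun ij : ι × ι => x ij.1 ij.2) P = 0}

/-- `V` is a `G`-stable closed subvariety of the nilpotent cone of `𝔤` (the cone is itself
Zariski closed in the space of matrices; irreducibility is not required). -/
structure IsStableClosedSubvariety (G : Subgroup (GL ι k))
    (𝔤 : LieSubalgebra k (Matrix ι ι k)) (V : Set (Matrix ι ι k)) : Prop where
  subset_nilpotentCone : V ⊆ nilpotentCone 𝔤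
  stable : ∀ g ∈ G, ∀ x ∈ V, Ad g x ∈ V
  closed : IsZariskiClosed V

/-- The set of `G`-orbits of `𝔰𝔩₂`-triples `(e, h, f)` in `𝔤` with `e, f ∈ V`. -/
def tripleOrbits (G : Subgroup (GL ι k)) (𝔤 : LieSubalgebra k (Matrix ι ι k))
    (V : Set (Matrix ι ι k)) : Set (Set (Matrix ι ι k × Matrix ι ι k × Matrix ι ι k)) :=
  {T | ∃ t, IsTriple 𝔤 t ∧ t.1 ∈ V ∧ t.2.2 ∈ V ∧ T = tripleOrbit G t}

/-- The set of `G`-orbits in `V`. -/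
def orbits (G : Subgroup (GL ι k)) (V : Set (Matrix ι ι k)) : Set (Set (Matrix ι ι k)) :=
  {O | ∃ x ∈ V, O = orbit G x}

/-- The image of the orbit of a triple `(e, h, f)` under the first projection is the orbit
of `e`. -/
theorem fst_image_tripleOrbit (G : Subgroup (GL ι k))
    (t : Matrix ι ι k × Matrix ι ι k × Matrix ι ι k) :
    Prod.fst '' tripleOrbit G t = orbit G t.1 := by
  ext y
  constructor
  · rintro ⟨_, ⟨g, hg, rfl⟩, rfl⟩
    exact ⟨g, hg, rfl⟩
  · rintro ⟨g, hg, rfl⟩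
    exact ⟨_, ⟨g, hg, rfl⟩, rfl⟩

/-- The `𝔰𝔩₂`-property: the map sending the `G`-orbit of an `𝔰𝔩₂`-triple `(e, h, f)` with
`e, f ∈ V` to the `G`-orbit of `e` (which is the first projection of the orbit of the triple) is
a bijection onto the set of `G`-orbits in `V`. -/
def HasSl2Property (G : Subgroup (GL ι k)) (𝔤 : LieSubalgebra k (Matrix ι ι k))
    (V : Set (Matrix ι ι k)) : Prop :=
  Set.BijOn (fun T => Prod.fst '' T) (tripleOrbits G 𝔤 V) (orbits G V)

end Sl2Property

end ClassicalSl2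

/-!
Let `V` be a stable closed set of nilpotent elements containing an element whose `p`-th power is
nonzero. We find an `e ∈ V` with `e ^ p ≠ 0` that is the first member of two non-conjugate
`𝔰𝔩₂`-triples whose third members are in `V`; so the map on orbits is not injective.

In characteristic `p` the element `z = e ^ p` commutes with every `h` and `f` completing `e` to a
triple. This allows the standard triple on a Jordan block of size `N` to be deformed: for any
scalar `c` there is an operator `y` of weight `-2` with `[e, y] = z`, namely
`v_i ↦ (i - (N - 2) / 2) v_{i - p + 1}`, and `(e, h + c z, f + c y)` is again a triple. Moreover
`(h + c z) - (h + c z) ^ p = c z`, since the weights of `h` are in the prime field and `z ^ p = 0`.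
Hence `c` is an invariant of the triple up to conjugation (`IsDeformedTriple`), and the values
`c = 1` and `c = -1` give non-conjugate triples with the same `e`. The operators `h` and `y` are
skew-adjoint for the form preserved by the block. For `N = p + 1` and `N = p + 2` and `c ≠ 0`, the
operator `f + c y` is itself a single Jordan block, which is conjugate to `e` by an isometry, so it
remains in `V` (`exists_deformed_triple`).

It remains to find in `V` an element which is zero outside such a block, or, in the orthogonal case,
outside a dual pair of blocks of size `p + 1`. It is an element `x ∈ V` with `x ^ p ≠ 0` of least
possible rank. For a nonzero `u` in the kernel and the image of `x`, a one-parameter torus acting on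
`u` and on a dual isotropic vector degenerates `x` to an element of `V` of smaller rank, whose
`p`-th power must vanish. This says that `x ^ p` maps the hyperplane orthogonal to `u` into the line
spanned by `u` (`pow_mulVec_mem_span_of_minimal_form`), which bounds the size of the largest Jordan
block and forces `x` to vanish on the complement of the block
(`exists_deformed_triples_of_stable_form`). For `GL` the argument is the same without the form
(`exists_deformed_triples_of_stable`), and `SL`-stable sets are `GL`-stable.
-/

namespace ClassicalSl2

/-! ### Model triples on a Jordan block -/

section ModelTriples

variable {k : Type*} [Field k]

/-- The nilpotent Jordan block of size `N`, sending the basis vector `v_{j+1}` to `v_j`. -/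
def jordanBlock (k : Type*) [Field k] (N : ℕ) : Matrix (Fin N) (Fin N) k :=
  of fun i j => if (i : ℕ) + 1 = j then 1 else 0

/-- The Gram matrix with `⟨v_i, v_{N-1-i}⟩ = (-1)^i` and all other pairings zero. The Jordan block
is skew-adjoint for it; it is symmetric for odd `N` and alternating for even `N`. -/
def antidiagForm (k : Type*) [Field k] (N : ℕ) : Matrix (Fin N) (Fin N) k :=
  of fun i j => if (i : ℕ) + j + 1 = N then (-1) ^ (i : ℕ) else 0

/-- The diagonal matrix with the weights `N - 1 - 2 i` of the standard `N`-dimensional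
representation of `𝔰𝔩₂`. -/
def weightMatrix (k : Type*) [Field k] (N : ℕ) : Matrix (Fin N) (Fin N) k :=
  diagonal fun i => (N : k) - 1 - 2 * (i : ℕ)

/-- The third member of the deformed triple: the standard lowering operator plus `c` times an
operator lowering the index of a basis vector by `p - 1`. The latter has weight `2 (p - 1) = -2` in
characteristic `p`. -/
def deformedLowering (k : Type*) [Field k] (p N : ℕ) (c : k) : Matrix (Fin N) (Fin N) k :=
  of fun i j => (if (j : ℕ) + 1 = i then (i : ℕ) * ((N : k) - (i : ℕ)) else 0) +
    c * (if (i : ℕ) + p = j + 1 then ((i : ℕ) : k) - N / 2 else 0)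

theorem jordanBlock_mul_apply {ι : Type*} (N : ℕ) (M : Matrix (Fin N) ι k) (i : Fin N) (j : ι) :
    (jordanBlock k N * M) i j = if h : (i : ℕ) + 1 < N then M ⟨i + 1, h⟩ j else 0 := by
  rw [mul_apply]
  split_ifs with h
  · rw [Finset.sum_eq_single ⟨(i : ℕ) + 1, h⟩]
    · simp [jordanBlock]
    · intro b _ hb
      have : (i : ℕ) + 1 ≠ b := fun h' => hb (Fin.ext h'.symm)
      simp [jordanBlock, this]
    · simp
  · refine Finset.sum_eq_zero fun b _ => ?_
    have : (i : ℕ) + 1 ≠ b := by have := b.2; omega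
    simp [jordanBlock, this]

theorem mul_jordanBlock_apply {ι : Type*} (N : ℕ) (M : Matrix ι (Fin N) k) (i : ι) (j : Fin N) :
    (M * jordanBlock k N) i j =
      if 0 < (j : ℕ) then M i ⟨j - 1, (Nat.sub_le _ _).trans_lt j.2⟩ else 0 := by
  rw [mul_apply]
  split_ifs with h
  · rw [Finset.sum_eq_single ⟨(j : ℕ) - 1, (Nat.sub_le _ _).trans_lt j.2⟩]
    · have : (j : ℕ) - 1 + 1 = j := by omega
      simp [jordanBlock, this]
    · intro b _ hb
      have : (b : ℕ) + 1 ≠ j := fun h' => hb (Fin.ext (by simp only; omega))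
      simp [jordanBlock, this]
    · simp
  · refine Finset.sum_eq_zero fun b _ => ?_
    have : (b : ℕ) + 1 ≠ j := by omega
    simp [jordanBlock, this]

theorem jordanBlock_pow_apply (N s : ℕ) (i j : Fin N) :
    (jordanBlock k N ^ s) i j = if (i : ℕ) + s = j then 1 else 0 := by
  induction s generalizing i with
  | zero => simp [one_apply, Fin.ext_iff]
  | succ s ih =>
    rw [pow_succ', jordanBlock_mul_apply]
    have := j.2
    split_ifs with h h' h'
    · rw [ih, if_pos (by simp only; omega)]
    · rw [ih, if_neg (by simp only; omega)]
    · omega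
    · rfl

theorem jordanBlock_pow_ne_zero {N s : ℕ} (h : s < N) : jordanBlock k N ^ s ≠ 0 := by
  intro h0
  have := congrFun (congrFun h0 ⟨0, by omega⟩) ⟨s, h⟩
  rw [jordanBlock_pow_apply] at this
  simp at this

theorem weightMatrix_mul_jordanBlock (N : ℕ) :
    weightMatrix k N * jordanBlock k N - jordanBlock k N * weightMatrix k N
      = (2 : k) • jordanBlock k N := by
  ext i j
  simp only [weightMatrix, Matrix.sub_apply, diagonal_mul, mul_diagonal, jordanBlock, of_apply,
    Matrix.smul_apply, smul_eq_mul]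
  split_ifs with h
  · rw [← h]; push_cast; ring
  · ring

theorem weightMatrix_mul_deformedLowering (p : ℕ) [CharP k p] (N : ℕ) (c : k) :
    weightMatrix k N * deformedLowering k p N c - deformedLowering k p N c * weightMatrix k N
      = (-2 : k) • deformedLowering k p N c := by
  have hp : (p : k) = 0 := CharP.cast_eq_zero k p
  ext i j
  simp only [weightMatrix, Matrix.sub_apply, diagonal_mul, mul_diagonal, deformedLowering, of_apply,
    Matrix.smul_apply, smul_eq_mul]
  split_ifs with h1 h2 h2
  · have h1' := congrArg (Nat.cast : ℕ → k) h1
    push_cast at h1'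
    linear_combination 2 * ((i : ℕ) * ((N : k) - (i : ℕ)) + c * ((i : ℕ) - (N : k) / 2)) * h1'
  · have h1' := congrArg (Nat.cast : ℕ → k) h1
    push_cast at h1'
    linear_combination 2 * ((i : ℕ) * ((N : k) - (i : ℕ))) * h1'
  · have h2' := congrArg (Nat.cast : ℕ → k) h2
    push_cast at h2'
    rw [hp] at h2'
    linear_combination (-2 * c * ((i : ℕ) - (N : k) / 2)) * h2'
  · ring

theorem jordanBlock_mul_deformedLowering {p : ℕ} (hp : 0 < p) (N : ℕ) (c : k) :
    jordanBlock k N * deformedLowering k p N c - deformedLowering k p N c * jordanBlock k N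
      = weightMatrix k N + c • jordanBlock k N ^ p := by
  ext i j
  rw [Matrix.sub_apply, jordanBlock_mul_apply, mul_jordanBlock_apply, Matrix.add_apply,
    Matrix.smul_apply, jordanBlock_pow_apply, weightMatrix, diagonal_apply]
  obtain ⟨a, ha⟩ := i
  obtain ⟨b, hb⟩ := j
  simp only [deformedLowering, of_apply, smul_eq_mul, Fin.mk.injEq]
  have e1 : (b + 1 = a + 1) ↔ a = b := by omega
  have e2 : (a + 1 + p = b + 1) ↔ a + p = b := by omega
  have e3 : 0 < b → ((b - 1 + 1 = a) ↔ a = b) := by omega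
  have e4 : 0 < b → ((a + p = b - 1 + 1) ↔ a + p = b) := by omega
  have q1 : (if h : a + 1 < N then (if b + 1 = a + 1 then
        ((a + 1 : ℕ) : k) * ((N : k) - ((a + 1 : ℕ) : k)) else 0) +
        c * (if a + 1 + p = b + 1 then ((a + 1 : ℕ) : k) - N / 2 else 0) else 0)
      = (if a = b then ((a : k) + 1) * ((N : k) - (a + 1)) else 0) +
        c * (if a + p = b ∧ a + 1 < N then (a : k) + 1 - N / 2 else 0) := by
    by_cases h : a + 1 < N
    · simp only [h, dif_pos, e1, e2, and_true]; push_cast; rfl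
    · have h' : (N : k) = a + 1 := by
        have : N = a + 1 := by omega
        rw [this]; push_cast; rfl
      simp [h, h']
  have q2 : (if 0 < b then (if b - 1 + 1 = a then (a : k) * ((N : k) - a) else 0) +
        c * (if a + p = b - 1 + 1 then (a : k) - N / 2 else 0) else 0)
      = (if a = b then (a : k) * ((N : k) - a) else 0) +
        c * (if a + p = b ∧ 0 < b then (a : k) - N / 2 else 0) := by
    by_cases h : 0 < b
    · simp only [h, if_true, e3 h, e4 h, and_true]
    · have h' : b = 0 := by omega
      subst h'
      by_cases h0 : a = 0 <;> simp [h0]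
  rw [q1, q2]
  have h1 : a + p = b → a + 1 < N := by omega
  have h2 : a + p = b → 0 < b := by omega
  have h3 : (a + p = b ∧ a + 1 < N) ↔ a + p = b := ⟨And.left, fun h => ⟨h, h1 h⟩⟩
  have h4 : (a + p = b ∧ 0 < b) ↔ a + p = b := ⟨And.left, fun h => ⟨h, h2 h⟩⟩
  simp only [h3, h4]
  split_ifs <;> ring

theorem weight_mul_pow {A : Type*} [Ring A] {e h : A} (he : h * e - e * h = 2 * e) (n : ℕ) :
    h * e ^ n = e ^ n * h + (2 * n) • e ^ n := by
  have he' : h * e = e * h + 2 • e := by rw [two_nsmul, ← two_mul, ← he]; abel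
  induction n with
  | zero => simp
  | succ n ih =>
    rw [pow_succ, ← mul_assoc, ih, add_mul, mul_assoc, he', smul_mul_assoc, mul_add, ← mul_assoc,
      mul_smul_comm, ← pow_succ]
    module

theorem pow_mul_lowering {A : Type*} [Ring A] {e h f : A} (he : h * e - e * h = 2 * e)
    (hf : e * f - f * e = h) (n : ℕ) :
    e ^ (n + 1) * f = f * e ^ (n + 1) + (n + 1) • (e ^ n * h) + (n * (n + 1)) • e ^ n := by
  have hf' : e * f = f * e + h := by rw [← hf]; abel
  induction n with
  | zero => simp [hf']
  | succ n ih =>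
    rw [pow_succ' e (n + 1), mul_assoc, ih, mul_add, mul_add, ← mul_assoc e f, hf', add_mul,
      weight_mul_pow he, mul_assoc f, ← pow_succ', mul_smul_comm, mul_smul_comm, ← mul_assoc e,
      ← pow_succ']
    module

/-- In characteristic `p`, the `p`-th power of the first member of an `𝔰𝔩₂`-triple commutes with
the second. -/
theorem commute_pow_char_weight {ι : Type*} [Fintype ι] [DecidableEq ι] (p : ℕ) [CharP k p]
    {e h : Matrix ι ι k} (he : h * e - e * h = (2 : k) • e) : Commute (e ^ p) h := by
  have he' : h * e - e * h = 2 * e := by rw [he, two_smul, two_mul]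
  have := weight_mul_pow he' p
  rw [← Nat.cast_smul_eq_nsmul k, Nat.cast_mul, CharP.cast_eq_zero k p, mul_zero, zero_smul,
    add_zero] at this
  exact this.symm

/-- In characteristic `p`, the `p`-th power of the first member of an `𝔰𝔩₂`-triple commutes with
the third. -/
theorem commute_pow_char_lowering {ι : Type*} [Fintype ι] [DecidableEq ι] (p : ℕ) [CharP k p]
    (hp : 0 < p) {e h f : Matrix ι ι k} (he : h * e - e * h = (2 : k) • e)
    (hf : e * f - f * e = h) : Commute (e ^ p) f := by
  have he' : h * e - e * h = 2 * e := by rw [he, two_smul, two_mul]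
  obtain ⟨n, rfl⟩ : ∃ n, p = n + 1 := ⟨p - 1, by omega⟩
  have h0 : ((n + 1 : ℕ) : k) = 0 := CharP.cast_eq_zero k (n + 1)
  have := pow_mul_lowering he' hf n
  rw [← Nat.cast_smul_eq_nsmul k, ← Nat.cast_smul_eq_nsmul k, Nat.cast_mul, h0, mul_zero,
    zero_smul, zero_smul, add_zero, add_zero] at this
  exact this

theorem weightMatrix_pow_char (p : ℕ) [Fact p.Prime] [CharP k p] (N : ℕ) :
    weightMatrix k N ^ p = weightMatrix k N := by
  rw [weightMatrix, diagonal_pow]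
  congr 1
  ext i
  have : (N : k) - 1 - 2 * (i : ℕ) = ((N - 1 - 2 * (i : ℕ) : ℤ) : k) := by push_cast; ring
  rw [Pi.pow_apply, this, ← frobenius_def, map_intCast]

end ModelTriples

/-! ### Isometric conjugation of the third member to the first -/

section CyclicFrames

variable {k : Type*} [Field k]

theorem antidiagForm_mul_apply {ι : Type*} (N : ℕ) (M : Matrix (Fin N) ι k) (i : Fin N) (j : ι) :
    (antidiagForm k N * M) i j = (-1) ^ (i : ℕ) * M i.rev j := by
  rw [mul_apply, Finset.sum_eq_single i.rev]
  · have : (i : ℕ) + i.rev + 1 = N := by have := i.2; rw [Fin.val_rev]; omega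
    simp only [antidiagForm, of_apply, if_pos this]
  · intro b _ hb
    have : ¬ (i : ℕ) + b + 1 = N := fun h => hb (Fin.ext (by rw [Fin.val_rev]; omega))
    simp only [antidiagForm, of_apply, if_neg this, zero_mul]
  · simp

theorem mul_antidiagForm_apply {ι : Type*} (N : ℕ) (M : Matrix ι (Fin N) k) (i : ι) (j : Fin N) :
    (M * antidiagForm k N) i j = M i j.rev * (-1) ^ (j.rev : ℕ) := by
  rw [mul_apply, Finset.sum_eq_single j.rev]
  · have : (j.rev : ℕ) + j + 1 = N := by have := j.2; rw [Fin.val_rev]; omega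
    simp only [antidiagForm, of_apply, if_pos this]
  · intro b _ hb
    have : ¬ (b : ℕ) + j + 1 = N := fun h => hb (Fin.ext (by rw [Fin.val_rev]; omega))
    simp only [antidiagForm, of_apply, if_neg this, mul_zero]
  · simp

theorem antidiagForm_mul_self (N : ℕ) :
    antidiagForm k N * antidiagForm k N = (-1 : k) ^ (N - 1) • (1 : Matrix (Fin N) (Fin N) k) := by
  ext i j
  have hi := i.2
  rw [antidiagForm_mul_apply, antidiagForm, of_apply, Matrix.smul_apply, one_apply, Fin.val_rev,
    smul_eq_mul, mul_ite, mul_zero, mul_ite, mul_zero, ← pow_add, mul_one]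
  have h1 : (N - (i + 1) + (j : ℕ) + 1 = N) ↔ i = j := by rw [Fin.ext_iff]; omega
  have h2 : (i : ℕ) + (N - (i + 1)) = N - 1 := by omega
  simp only [h1, h2]

theorem isUnit_det_antidiagForm (N : ℕ) : IsUnit (antidiagForm k N).det := by
  rw [← isUnit_iff_isUnit_det]
  refine IsUnit.of_mul_eq_one ((-1 : k) ^ (N - 1) • antidiagForm k N) ?_
  rw [mul_smul_comm, antidiagForm_mul_self, smul_smul, ← mul_pow]
  simp

/-- If `x` is skew-adjoint for `J`, then moving `x ^ a` across the form costs `(-1) ^ a`. -/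
theorem transpose_pow_mul_of_skew {ι : Type*} [Fintype ι] [DecidableEq ι] {J x : Matrix ι ι k}
    (hx : xᵀ * J = -(J * x)) (a : ℕ) : (x ^ a)ᵀ * J = (-1 : k) ^ a • (J * x ^ a) := by
  induction a with
  | zero => simp
  | succ a ih =>
    rw [pow_succ, transpose_mul, Matrix.mul_assoc, ih, mul_smul_comm, ← Matrix.mul_assoc, hx,
      pow_succ, neg_mul, smul_neg, mul_neg_one, neg_smul, Matrix.mul_assoc, ← pow_succ,
      ← pow_succ']

theorem pow_mulVec_form {ι : Type*} [Fintype ι] [DecidableEq ι] {J x : Matrix ι ι k}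
    (hx : xᵀ * J = -(J * x)) (a : ℕ) (u w : ι → k) :
    (x ^ a *ᵥ u) ⬝ᵥ J *ᵥ w = (-1) ^ a * (u ⬝ᵥ J *ᵥ (x ^ a *ᵥ w)) := by
  rw [← vecMul_transpose, ← dotProduct_mulVec, mulVec_mulVec, transpose_pow_mul_of_skew hx,
    smul_mulVec, dotProduct_smul, smul_eq_mul, mulVec_mulVec]

theorem form_symm {ι : Type*} [Fintype ι] {J : Matrix ι ι k} {ε : k}
    (hε : ε = 1 ∨ ε = -1) (hJ : Jᵀ = ε • J) (a b : ι → k) : a ⬝ᵥ J *ᵥ b = ε * (b ⬝ᵥ J *ᵥ a) := by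
  have hεε : ε * ε = 1 := by rcases hε with rfl | rfl <;> simp
  have : J = ε • Jᵀ := by rw [hJ, smul_smul, hεε, one_smul]
  conv_lhs => rw [this, smul_mulVec, dotProduct_smul, mulVec_transpose, dotProduct_comm,
    ← dotProduct_mulVec]
  rfl

/-- The matrix with columns `x ^ (N - 1) v, …, x v, v`. -/
def cyclicFrame {ι : Type*} [Fintype ι] [DecidableEq ι] (x : Matrix ι ι k) (v : ι → k) (N : ℕ) :
    Matrix ι (Fin N) k :=
  of fun i j => (x ^ (N - 1 - (j : ℕ)) *ᵥ v) i

theorem mul_cyclicFrame {ι : Type*} [Fintype ι] [DecidableEq ι] {x : Matrix ι ι k} {v : ι → k}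
    {N : ℕ} (h : x ^ N *ᵥ v = 0) :
    x * cyclicFrame x v N = cyclicFrame x v N * jordanBlock k N := by
  ext i j
  have hj := j.2
  rw [mul_jordanBlock_apply]
  have h1 : (x * cyclicFrame x v N) i j = (x ^ (N - 1 - (j : ℕ) + 1) *ᵥ v) i := by
    rw [pow_succ', ← mulVec_mulVec]; rfl
  rw [h1]
  split_ifs with h0
  · have : N - 1 - (j : ℕ) + 1 = N - 1 - (j - 1) := by omega
    rw [this]; rfl
  · have : N - 1 - (j : ℕ) + 1 = N := by omega
    rw [this, h]; rfl

/-- A vector `v` with `x ^ N v = 0` whose only nonzero pairing with the vectors `x ^ i v` is the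
one with `x ^ (N - 1) v` spans, after rescaling, a copy of the standard Jordan block with the
standard form. -/
theorem exists_frame_of_skew [IsAlgClosed k] {ι : Type*} [Fintype ι] [DecidableEq ι]
    {J x : Matrix ι ι k} (hx : xᵀ * J = -(J * x)) {v : ι → k} {N : ℕ} (h : x ^ N *ᵥ v = 0)
    (hlow : ∀ i < N - 1, v ⬝ᵥ J *ᵥ (x ^ i *ᵥ v) = 0)
    (htop : v ⬝ᵥ J *ᵥ (x ^ (N - 1) *ᵥ v) ≠ 0) :
    ∃ α : k, x * cyclicFrame x (α • v) N = cyclicFrame x (α • v) N * jordanBlock k N ∧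
      (cyclicFrame x (α • v) N)ᵀ * J * cyclicFrame x (α • v) N = antidiagForm k N := by
  obtain ⟨α, hα⟩ := IsAlgClosed.exists_pow_nat_eq
    ((-1) ^ (N - 1) * (v ⬝ᵥ J *ᵥ (x ^ (N - 1) *ᵥ v))⁻¹) (n := 2) (by norm_num)
  -- Squares of scalars suffice: the pairing of `v` with `x ^ (N - 1) v` is quadratic in `v`.
  refine ⟨α, mul_cyclicFrame (by rw [mulVec_smul, h, smul_zero]), ?_⟩
  have hgram : ∀ i, (α • v) ⬝ᵥ J *ᵥ (x ^ i *ᵥ (α • v)) =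
      if i = N - 1 then (-1) ^ (N - 1) else 0 := by
    intro i
    rw [mulVec_smul, mulVec_smul, dotProduct_smul, smul_dotProduct, smul_smul, ← pow_two, hα,
      smul_eq_mul]
    split_ifs with hi
    · rw [hi, mul_assoc, inv_mul_cancel₀ htop, mul_one]
    · rcases lt_or_ge i (N - 1) with h' | h'
      · rw [hlow i h', mul_zero]
      · obtain ⟨d, rfl⟩ := Nat.exists_eq_add_of_le' (show N ≤ i by omega)
        rw [pow_add, ← mulVec_mulVec, h]; simp
  ext i j
  have hi := i.2
  have hj := j.2
  have h1 : ((cyclicFrame x (α • v) N)ᵀ * J * cyclicFrame x (α • v) N) i j =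
      (x ^ (N - 1 - (i : ℕ)) *ᵥ (α • v)) ⬝ᵥ J *ᵥ (x ^ (N - 1 - (j : ℕ)) *ᵥ (α • v)) := by
    rw [Matrix.mul_assoc]; rfl
  rw [h1, pow_mulVec_form hx, mulVec_mulVec (α • v), ← pow_add, hgram, antidiagForm, of_apply]
  have h2 : (N - 1 - (i : ℕ) + (N - 1 - j) = N - 1) ↔ (i : ℕ) + j + 1 = N := by omega
  simp only [h2]
  split_ifs with h3
  · rw [← pow_add]
    have : N - 1 - (i : ℕ) + (N - 1) = i + 2 * (N - 1 - i) := by omega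
    rw [this, pow_add, pow_mul]; simp
  · simp

theorem deformedLowering_skew {p : ℕ} [CharP k p] (hp : Odd p) (h2 : (2 : k) ≠ 0) (N : ℕ) (c : k) :
    (deformedLowering k p N c)ᵀ * antidiagForm k N =
      -(antidiagForm k N * deformedLowering k p N c) := by
  have hp0 : (p : k) = 0 := CharP.cast_eq_zero k p
  ext i j
  rw [mul_antidiagForm_apply, Matrix.neg_apply, antidiagForm_mul_apply, transpose_apply]
  have hi := i.2
  have hj := j.2
  obtain ⟨a, ha⟩ : ∃ a : ℕ, a = j.rev := ⟨_, rfl⟩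
  obtain ⟨b, hb⟩ : ∃ b : ℕ, b = i.rev := ⟨_, rfl⟩
  simp only [deformedLowering, of_apply, ← ha, ← hb]
  rw [Fin.val_rev] at ha hb
  have e1 : ((j : ℕ) + 1 = b) ↔ (i : ℕ) + 1 = a := by omega
  have e2 : (b + p = j + 1) ↔ a + p = i + 1 := by omega
  have hbN : (b : k) = N - 1 - (i : ℕ) := by
    have := congrArg (Nat.cast : ℕ → k) (show N = b + i + 1 by omega)
    push_cast at this
    linear_combination -this
  simp only [e1, e2, hbN]
  have q1 : (if (i : ℕ) + 1 = a then (a : k) * (N - a) else 0) * (-1) ^ a =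
      -((-1) ^ (i : ℕ) *
        (if (i : ℕ) + 1 = a then ((N : k) - 1 - (i : ℕ)) * (N - (N - 1 - (i : ℕ))) else 0)) := by
    split_ifs with h
    · rw [← h]; push_cast; ring
    · simp
  have q2 : (if a + p = i + 1 then (a : k) - N / 2 else 0) * (-1) ^ a =
      -((-1) ^ (i : ℕ) * (if a + p = i + 1 then (N : k) - 1 - (i : ℕ) - N / 2 else 0)) := by
    split_ifs with h
    · obtain ⟨q, rfl⟩ := hp
      have hia : (i : ℕ) = a + 2 * q := by omega
      push_cast at hp0
      rw [hia, pow_add, pow_mul]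
      push_cast
      have : (2 * (q : k)) = -1 := by linear_combination hp0
      rw [this]
      field_simp
      simp
      ring
    · simp
  rw [add_mul, q1, mul_assoc, q2]
  ring

/-- The basis vector `v_j`, with `v_j = 0` for `j ≥ N`. -/
def basisVec (k : Type*) [Field k] (N j : ℕ) : Fin N → k := fun i => if (i : ℕ) = j then 1 else 0

theorem deformedLowering_mulVec_of_lt {p N j : ℕ} (c : k) (hjN : j < N) (h : j + 1 < p) :
    deformedLowering k p N c *ᵥ basisVec k N j =
      (((j + 1 : ℕ) : k) * (N - (j + 1 : ℕ))) • basisVec k N (j + 1) := by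
  ext i
  rw [mulVec, dotProduct, Finset.sum_eq_single ⟨j, hjN⟩]
  · have h1 : ¬ (i : ℕ) + p = j + 1 := by omega
    simp only [deformedLowering, of_apply, basisVec, h1, if_true, if_false, Pi.smul_apply]
    by_cases h2 : j + 1 = i
    · simp [h2]
    · simp [h2, Ne.symm h2]
  · intro b _ hb
    have : (b : ℕ) ≠ j := fun h => hb (Fin.ext h)
    simp [basisVec, this]
  · simp

theorem deformedLowering_mulVec_of_add {p N j : ℕ} (c : k) (s : ℕ) (hjN : j < N)
    (h : j + 1 = s + p) :
    deformedLowering k p N c *ᵥ basisVec k N j =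
      (((j + 1 : ℕ) : k) * (N - (j + 1 : ℕ))) • basisVec k N (j + 1) +
        (c * (s - N / 2)) • basisVec k N s := by
  ext i
  rw [mulVec, dotProduct, Finset.sum_eq_single ⟨j, hjN⟩]
  · have h1 : (i : ℕ) + p = j + 1 ↔ (i : ℕ) = s := by omega
    have h2 : j + 1 = i ↔ (i : ℕ) = j + 1 := eq_comm
    simp only [deformedLowering, of_apply, basisVec, h1, h2, if_true, mul_one, Pi.add_apply,
      Pi.smul_apply, smul_eq_mul]
    congr 1
    · split_ifs with h3 <;> simp [h3]
    · split_ifs with h3 <;> simp [h3]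
  · intro b _ hb
    have : (b : ℕ) ≠ j := fun h => hb (Fin.ext h)
    simp [basisVec, this]
  · simp

theorem basisVec_form_basisVec {N a b : ℕ} (ha : a < N) (hb : b < N) :
    basisVec k N a ⬝ᵥ antidiagForm k N *ᵥ basisVec k N b =
      if a + b + 1 = N then (-1) ^ a else 0 := by
  have h1 : basisVec k N a = Pi.single ⟨a, ha⟩ 1 := by
    ext i; simp [basisVec, Pi.single_apply, Fin.ext_iff]
  have h2 : basisVec k N b = Pi.single ⟨b, hb⟩ 1 := by
    ext i; simp [basisVec, Pi.single_apply, Fin.ext_iff]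
  rw [h1, h2]
  simp [antidiagForm]

theorem natCast_ne_zero_of_lt (p : ℕ) [CharP k p] {m : ℕ} (h0 : 0 < m) (h : m < p) :
    (m : k) ≠ 0 := by
  rw [Ne, CharP.cast_eq_zero_iff k p]
  exact Nat.not_dvd_of_pos_of_lt h0 h

/-- For block size `p + 1` the deformed lowering operator is a single nilpotent chain
`v_p, v_1, v_2, …, v_{p-1}, v_0` (up to scalars). -/
theorem deformedLowering_chain_add_one {p : ℕ} [CharP k p] (hp : 2 < p) (h2 : (2 : k) ≠ 0)
    {c : k} (hc : c ≠ 0) :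
    (∀ i, 1 ≤ i → i < p → ∃ γ : k, γ ≠ 0 ∧
      deformedLowering k p (p + 1) c ^ i *ᵥ basisVec k (p + 1) p = γ • basisVec k (p + 1) i) ∧
    (∃ γ : k, γ ≠ 0 ∧
      deformedLowering k p (p + 1) c ^ p *ᵥ basisVec k (p + 1) p = γ • basisVec k (p + 1) 0) ∧
    deformedLowering k p (p + 1) c ^ (p + 1) *ᵥ basisVec k (p + 1) p = 0 := by
  have hp0 : (p : k) = 0 := CharP.cast_eq_zero k p
  have A : ∀ i, 1 ≤ i → i < p → ∃ γ : k, γ ≠ 0 ∧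
      deformedLowering k p (p + 1) c ^ i *ᵥ basisVec k (p + 1) p = γ • basisVec k (p + 1) i := by
    intro i hi
    induction i, hi using Nat.le_induction with
    | base =>
      refine fun _ => ⟨c * (1 / 2), mul_ne_zero hc (one_div_ne_zero h2), ?_⟩
      rw [pow_one, deformedLowering_mulVec_of_add c 1 (by omega) (by omega)]
      push_cast
      rw [hp0]
      simp only [zero_add, sub_self, mul_zero, zero_smul]
      congr 2
      field_simp
      ring
    | succ i hi ih =>
      intro hip
      obtain ⟨γ, hγ, h⟩ := ih (by omega)
      refine ⟨γ * (((i + 1 : ℕ) : k) * (((p + 1 : ℕ) : k) - (i + 1 : ℕ))),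
        mul_ne_zero hγ (mul_ne_zero (natCast_ne_zero_of_lt p (by omega) hip) ?_), ?_⟩
      · push_cast
        rw [hp0]
        have := natCast_ne_zero_of_lt (k := k) p (show 0 < i by omega) (by omega)
        intro h'
        exact this (by linear_combination -h')
      · rw [pow_succ', ← mulVec_mulVec, h, mulVec_smul,
          deformedLowering_mulVec_of_lt c (by omega) (by omega), smul_smul]
  have B : ∃ γ : k, γ ≠ 0 ∧
      deformedLowering k p (p + 1) c ^ p *ᵥ basisVec k (p + 1) p = γ • basisVec k (p + 1) 0 := by
    obtain ⟨γ, hγ, h⟩ := A (p - 1) (by omega) (by omega)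
    refine ⟨γ * (c * (-(1 / 2))),
      mul_ne_zero hγ (mul_ne_zero hc (neg_ne_zero.2 (one_div_ne_zero h2))), ?_⟩
    have e : p - 1 + 1 = p := by omega
    rw [← mul_pow_sub_one (show p ≠ 0 by omega) (deformedLowering _ _ _ _), ← mulVec_mulVec, h,
      mulVec_smul, deformedLowering_mulVec_of_add c 0 (by omega) (by omega), e]
    push_cast
    rw [hp0]
    simp [smul_smul]
  refine ⟨A, B, ?_⟩
  obtain ⟨γ, hγ, h⟩ := B
  rw [pow_succ', ← mulVec_mulVec, h, mulVec_smul,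
    deformedLowering_mulVec_of_lt c (by omega) (by omega)]
  simp

/-- For block size `p + 2` the deformed lowering operator is a single nilpotent chain
`v_p, v_{p+1}, v_2, v_3, …, v_{p-1}, v_0, v_1` (up to scalars). -/
theorem deformedLowering_chain_add_two {p : ℕ} [CharP k p] (hp : 2 < p) (h2 : (2 : k) ≠ 0)
    {c : k} (hc : c ≠ 0) :
    (deformedLowering k p (p + 2) c *ᵥ basisVec k (p + 2) p = basisVec k (p + 2) (p + 1)) ∧
    (∀ i, 2 ≤ i → i < p → ∃ γ : k, γ ≠ 0 ∧
      deformedLowering k p (p + 2) c ^ i *ᵥ basisVec k (p + 2) p = γ • basisVec k (p + 2) i) ∧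
    (∃ γ : k, γ ≠ 0 ∧
      deformedLowering k p (p + 2) c ^ p *ᵥ basisVec k (p + 2) p = γ • basisVec k (p + 2) 0) ∧
    (∃ γ : k, γ ≠ 0 ∧
      deformedLowering k p (p + 2) c ^ (p + 1) *ᵥ basisVec k (p + 2) p
        = γ • basisVec k (p + 2) 1) ∧
    deformedLowering k p (p + 2) c ^ (p + 2) *ᵥ basisVec k (p + 2) p = 0 := by
  have hp0 : (p : k) = 0 := CharP.cast_eq_zero k p
  have Z : deformedLowering k p (p + 2) c *ᵥ basisVec k (p + 2) p
      = basisVec k (p + 2) (p + 1) := by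
    rw [deformedLowering_mulVec_of_add c 1 (by omega) (by omega)]
    push_cast
    rw [hp0]
    have h1 : (0 + 1 : k) * (0 + 2 - (0 + 1)) = 1 := by ring
    have h3 : c * (1 - (0 + 2) / 2) = 0 := by field_simp; ring
    rw [h1, h3, one_smul, zero_smul, add_zero]
  have A : ∀ i, 2 ≤ i → i < p → ∃ γ : k, γ ≠ 0 ∧
      deformedLowering k p (p + 2) c ^ i *ᵥ basisVec k (p + 2) p = γ • basisVec k (p + 2) i := by
    intro i hi
    induction i, hi using Nat.le_induction with
    | base =>
      refine fun _ => ⟨c, hc, ?_⟩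
      rw [pow_two, ← mulVec_mulVec, Z,
        deformedLowering_mulVec_of_add c 2 (by omega) (by omega)]
      push_cast
      rw [hp0]
      have h1 : (0 + 1 + 1 : k) * (0 + 2 - (0 + 1 + 1)) = 0 := by ring
      have h3 : c * (2 - (0 + 2) / 2) = c := by field_simp; ring
      rw [h1, h3, zero_smul, zero_add]
    | succ i hi ih =>
      intro hip
      obtain ⟨γ, hγ, h⟩ := ih (by omega)
      refine ⟨γ * (((i + 1 : ℕ) : k) * (((p + 2 : ℕ) : k) - (i + 1 : ℕ))),
        mul_ne_zero hγ (mul_ne_zero (natCast_ne_zero_of_lt p (by omega) hip) ?_), ?_⟩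
      · have := natCast_ne_zero_of_lt (k := k) p (show 0 < i - 1 by omega) (by omega)
        rw [Nat.cast_sub (by omega)] at this
        push_cast at this ⊢
        rw [hp0]
        intro h'
        exact this (by linear_combination -h')
      · rw [pow_succ', ← mulVec_mulVec, h, mulVec_smul,
          deformedLowering_mulVec_of_lt c (by omega) (by omega), smul_smul]
  have B : ∃ γ : k, γ ≠ 0 ∧
      deformedLowering k p (p + 2) c ^ p *ᵥ basisVec k (p + 2) p = γ • basisVec k (p + 2) 0 := by
    obtain ⟨γ, hγ, h⟩ := A (p - 1) (by omega) (by omega)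
    refine ⟨γ * -c, mul_ne_zero hγ (neg_ne_zero.2 hc), ?_⟩
    have e : p - 1 + 1 = p := by omega
    rw [← mul_pow_sub_one (show p ≠ 0 by omega) (deformedLowering _ _ _ _), ← mulVec_mulVec, h,
      mulVec_smul, deformedLowering_mulVec_of_add c 0 (by omega) (by omega), e]
    push_cast
    rw [hp0]
    simp [smul_smul, h2]
  have C : ∃ γ : k, γ ≠ 0 ∧
      deformedLowering k p (p + 2) c ^ (p + 1) *ᵥ basisVec k (p + 2) p
        = γ • basisVec k (p + 2) 1 := by
    obtain ⟨γ, hγ, h⟩ := B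
    refine ⟨γ, hγ, ?_⟩
    rw [pow_succ', ← mulVec_mulVec, h, mulVec_smul,
      deformedLowering_mulVec_of_lt c (by omega) (by omega)]
    have h1 : ((0 + 1 : ℕ) : k) * (((p + 2 : ℕ) : k) - (0 + 1 : ℕ)) = 1 := by
      push_cast; rw [hp0]; ring
    rw [h1, one_smul]
  refine ⟨Z, A, B, C, ?_⟩
  obtain ⟨γ, hγ, h⟩ := C
  rw [pow_succ' _ (p + 1), ← mulVec_mulVec, h, mulVec_smul,
    deformedLowering_mulVec_of_lt c (by omega) (by omega)]
  have h1 : ((1 + 1 : ℕ) : k) * (((p + 2 : ℕ) : k) - (1 + 1 : ℕ)) = 0 := by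
    push_cast; rw [hp0]; ring
  rw [h1, zero_smul, smul_zero]

theorem deformedLowering_cyclic {p : ℕ} [CharP k p] (hp : 2 < p) (h2 : (2 : k) ≠ 0) {N : ℕ}
    (hN : N = p + 1 ∨ N = p + 2) {c : k} (hc : c ≠ 0) :
    deformedLowering k p N c ^ N *ᵥ basisVec k N p = 0 ∧
    (∀ i < N - 1, basisVec k N p ⬝ᵥ antidiagForm k N *ᵥ
      (deformedLowering k p N c ^ i *ᵥ basisVec k N p) = 0) ∧
    basisVec k N p ⬝ᵥ antidiagForm k N *ᵥ
      (deformedLowering k p N c ^ (N - 1) *ᵥ basisVec k N p) ≠ 0 := by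
  have key : ∀ (i j : ℕ), p < N → j < N → (∃ γ : k, γ ≠ 0 ∧
      deformedLowering k p N c ^ i *ᵥ basisVec k N p = γ • basisVec k N j) →
      (p + j + 1 ≠ N → basisVec k N p ⬝ᵥ antidiagForm k N *ᵥ
        (deformedLowering k p N c ^ i *ᵥ basisVec k N p) = 0) ∧
      (p + j + 1 = N → basisVec k N p ⬝ᵥ antidiagForm k N *ᵥ
        (deformedLowering k p N c ^ i *ᵥ basisVec k N p) ≠ 0) := by
    rintro i j hpN hj ⟨γ, hγ, h⟩
    rw [h, mulVec_smul, dotProduct_smul, basisVec_form_basisVec hpN hj, smul_eq_mul]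
    refine ⟨fun h' => by rw [if_neg h', mul_zero], fun h' => ?_⟩
    rw [if_pos h']
    exact mul_ne_zero hγ (pow_ne_zero _ (neg_ne_zero.2 one_ne_zero))
  have h0 : ∃ γ : k, γ ≠ 0 ∧
      deformedLowering k p N c ^ 0 *ᵥ basisVec k N p = γ • basisVec k N p :=
    ⟨1, one_ne_zero, by simp⟩
  rcases hN with rfl | rfl
  · obtain ⟨A, B, C⟩ := deformedLowering_chain_add_one hp h2 hc
    refine ⟨C, fun i hi => ?_, (key p 0 (by omega) (by omega) B).2 (by omega)⟩
    rcases Nat.eq_zero_or_pos i with rfl | hi0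
    · exact (key 0 p (by omega) (by omega) h0).1 (by omega)
    · exact (key i i (by omega) (by omega) (A i hi0 (by omega))).1 (by omega)
  · obtain ⟨Z, A, B, C, D⟩ := deformedLowering_chain_add_two hp h2 hc
    refine ⟨D, fun i hi => ?_, (key (p + 1) 1 (by omega) (by omega) C).2 (by omega)⟩
    rcases Nat.eq_zero_or_pos i with rfl | hi0
    · exact (key 0 p (by omega) (by omega) h0).1 (by omega)
    rcases eq_or_ne i 1 with rfl | hi1
    · exact (key 1 (p + 1) (by omega) (by omega)
        ⟨1, one_ne_zero, by rw [pow_one, Z, one_smul]⟩).1 (by omega)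
    rcases eq_or_ne i p with rfl | hip
    · exact (key i 0 (by omega) (by omega) B).1 (by omega)
    · exact (key i i (by omega) (by omega) (A i (by omega) (by omega))).1 (by omega)

/-- The commutator relations of an `𝔰𝔩₂`-triple `(e, h, f)` of matrices, together with the relation
`h - h ^ p = c • e ^ p`, which makes `c` an invariant of the triple up to simultaneous conjugation
as long as `e ^ p ≠ 0`. -/
structure IsDeformedTriple {ι : Type*} [Fintype ι] [DecidableEq ι] (p : ℕ) (c : k)
    (e h f : Matrix ι ι k) : Prop where
  weight_raising : h * e - e * h = (2 : k) • e
  weight_lowering : h * f - f * h = (-2 : k) • f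
  raising_lowering : e * f - f * e = h
  sub_pow : h - h ^ p = c • e ^ p

/-- The deformed triple on a Jordan block of size `p + 1` or `p + 2`: its third member is conjugate
to the first by an isometry. -/
theorem exists_deformed_triple [IsAlgClosed k] {p : ℕ} [CharP k p] (hp : 2 < p) {N : ℕ}
    (hN : N = p + 1 ∨ N = p + 2) {c : k} (hc : c ≠ 0) :
    ∃ h f g : Matrix (Fin N) (Fin N) k,
      IsDeformedTriple p c (jordanBlock k N) h f ∧
      gᵀ * antidiagForm k N * g = antidiagForm k N ∧ (Odd N → g.det = 1) ∧
      g * jordanBlock k N = f * g := by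
  have hprime : Fact p.Prime := ⟨(CharP.char_is_prime_or_zero k p).resolve_right (by omega)⟩
  have hodd : Odd p := hprime.out.odd_of_ne_two (by omega)
  have h2 : (2 : k) ≠ 0 := by
    exact_mod_cast natCast_ne_zero_of_lt (k := k) p (show 0 < 2 by omega) hp
  have hef := jordanBlock_mul_deformedLowering (show 0 < p by omega) N c
  have hhe : (weightMatrix k N + c • jordanBlock k N ^ p) * jordanBlock k N -
      jordanBlock k N * (weightMatrix k N + c • jordanBlock k N ^ p)
      = (2 : k) • jordanBlock k N := by
    rw [← weightMatrix_mul_jordanBlock, add_mul, mul_add, smul_mul_assoc, mul_smul_comm,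
      ← pow_succ, ← pow_succ']
    abel
  have hcf := commute_pow_char_lowering p (by omega) hhe hef
  have hcw : Commute (jordanBlock k N ^ p) (weightMatrix k N) :=
    commute_pow_char_weight p (weightMatrix_mul_jordanBlock N)
  have hz : (jordanBlock k N ^ p) ^ p = 0 := by
    rw [← pow_mul]
    ext i j
    have hj := j.2
    have h3 : ¬ (i : ℕ) + p * p = j := by
      have : 3 * p ≤ p * p := Nat.mul_le_mul_right p hp
      omega
    rw [jordanBlock_pow_apply, if_neg h3]; rfl
  have hpow : (weightMatrix k N + c • jordanBlock k N ^ p) ^ p = weightMatrix k N := by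
    have : Nonempty (Fin N) := ⟨⟨0, by omega⟩⟩
    rw [add_pow_char_of_commute p (hcw.symm.smul_right c), smul_pow, hz, smul_zero, add_zero,
      weightMatrix_pow_char]
  obtain ⟨hC, hlow, htop⟩ := deformedLowering_cyclic hp h2 hN hc
  obtain ⟨α, h3, h4⟩ :=
    exists_frame_of_skew (deformedLowering_skew hodd h2 N c) hC hlow htop
  set g := cyclicFrame (deformedLowering k p N c) (α • basisVec k N p) N
  have hdet : g.det = 1 ∨ g.det = -1 := by
    have := congrArg det h4
    rw [det_mul, det_mul, det_transpose] at this
    have hu := (isUnit_det_antidiagForm (k := k) N).ne_zero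
    refine mul_self_eq_one_iff.1 (mul_right_cancel₀ hu ?_)
    rw [one_mul]
    linear_combination this
  have hhf : (weightMatrix k N + c • jordanBlock k N ^ p) * deformedLowering k p N c -
      deformedLowering k p N c * (weightMatrix k N + c • jordanBlock k N ^ p)
      = (-2 : k) • deformedLowering k p N c := by
    rw [← weightMatrix_mul_deformedLowering p, add_mul, mul_add, smul_mul_assoc, mul_smul_comm,
      hcf.eq]
    abel
  have hhp : (weightMatrix k N + c • jordanBlock k N ^ p) -
      (weightMatrix k N + c • jordanBlock k N ^ p) ^ p = c • jordanBlock k N ^ p := by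
    rw [hpow, add_sub_cancel_left]
  -- For odd `N` the isometry `-g` has the opposite determinant and conjugates in the same way.
  by_cases hd : Odd N ∧ g.det ≠ 1
  · refine ⟨_, _, -g, ⟨hhe, hhf, hef, hhp⟩, by simpa using h4, fun _ => ?_, by simpa using h3.symm⟩
    rw [det_neg, Fintype.card_fin, hd.1.neg_one_pow, hdet.resolve_left hd.2]
    simp
  · refine ⟨_, _, g, ⟨hhe, hhf, hef, hhp⟩, h4, fun ho => ?_, h3.symm⟩
    by_contra hne
    exact hd ⟨ho, hne⟩

end CyclicFrames

/-! ### Torus degenerations of an element of least rank -/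

section Degenerations

variable {k : Type*} [Field k] {ι : Type*}

/-- A Zariski closed set containing all but one point of a parametrized quadratic curve contains
the remaining point. -/
theorem IsZariskiClosed.quadratic_limit [Infinite k] {V : Set (Matrix ι ι k)}
    (hV : IsZariskiClosed V) {A B C : Matrix ι ι k} {s₀ : k}
    (h : ∀ s ≠ s₀, A + s • B + s ^ 2 • C ∈ V) : A + s₀ • B + s₀ ^ 2 • C ∈ V := by
  obtain ⟨S, rfl⟩ := hV
  intro P hP
  set q : Polynomial k := MvPolynomial.aeval (fun ij : ι × ι =>
    Polynomial.C (A ij.1 ij.2) + Polynomial.X * Polynomial.C (B ij.1 ij.2) +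
      Polynomial.X ^ 2 * Polynomial.C (C ij.1 ij.2)) P with hq
  have hev : ∀ s, q.eval s =
      MvPolynomial.eval (fun ij : ι × ι => (A + s • B + s ^ 2 • C) ij.1 ij.2) P := by
    intro s
    have := MvPolynomial.map_aeval (fun ij : ι × ι =>
      Polynomial.C (A ij.1 ij.2) + Polynomial.X * Polynomial.C (B ij.1 ij.2) +
      Polynomial.X ^ 2 * Polynomial.C (C ij.1 ij.2)) (Polynomial.evalRingHom s) P
    rw [hq, ← Polynomial.coe_evalRingHom, this, MvPolynomial.coe_eval₂Hom, MvPolynomial.eval,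
      MvPolynomial.coe_eval₂Hom]
    congr 1
    · ext a; simp
    · ext ij; simp only [map_add, map_mul, map_pow, Polynomial.coe_evalRingHom, Polynomial.eval_C,
        Polynomial.eval_X, Matrix.add_apply, Matrix.smul_apply, smul_eq_mul]
  have hq0 : q = 0 := by
    refine Polynomial.eq_zero_of_infinite_isRoot q ?_
    refine (Set.finite_singleton s₀).infinite_compl.mono fun s hs => ?_
    rw [Set.mem_ofPred_eq, Polynomial.IsRoot, hev]
    exact h s hs P hP
  rw [← hev, hq0, Polynomial.eval_zero]

variable [Fintype ι]

theorem rank_mul_lt {A B : Matrix ι ι k} {u w : ι → k} (hu : u ≠ 0) (hB : B *ᵥ w = u)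
    (hA : A *ᵥ u = 0) : (A * B).rank < B.rank := by
  have h1 : LinearMap.range (A * B).mulVecLin =
      LinearMap.range (A.mulVecLin.domRestrict (LinearMap.range B.mulVecLin)) := by
    rw [Matrix.mulVecLin_mul, LinearMap.range_comp, LinearMap.range_domRestrict]
  have h2 := LinearMap.finrank_range_add_finrank_ker
    (A.mulVecLin.domRestrict (LinearMap.range B.mulVecLin))
  have h3 : 0 < Module.finrank k
      (LinearMap.ker (A.mulVecLin.domRestrict (LinearMap.range B.mulVecLin))) := by
    let u' : LinearMap.range B.mulVecLin := ⟨u, w, hB⟩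
    have hu' : u' ∈ LinearMap.ker (A.mulVecLin.domRestrict (LinearMap.range B.mulVecLin)) := hA
    rw [Nat.pos_iff_ne_zero, Ne, Submodule.finrank_eq_zero]
    intro h
    rw [h, Submodule.mem_bot] at hu'
    exact hu (congrArg Subtype.val hu')
  rw [Matrix.rank, Matrix.rank, h1]
  omega

variable [DecidableEq ι]

/-- The torus degeneration attached to a vector `u` in the kernel and the image of `x` and a
functional taking the value one at `u`: if `x` has least rank among the elements of `V` with
nonzero `q`-th power, then the image of `x ^ q` lies in the line spanned by `u`. -/
theorem pow_mulVec_mem_span_of_minimal [Infinite k] {q : ℕ} (hq : q ≠ 0) {V : Set (Matrix ι ι k)}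
    (hV : IsZariskiClosed V) (hst : ∀ g g' : Matrix ι ι k, g * g' = 1 → ∀ x ∈ V, g * x * g' ∈ V)
    {x : Matrix ι ι k} (hxV : x ∈ V) (hmin : ∀ y ∈ V, y ^ q ≠ 0 → x.rank ≤ y.rank)
    {u y : ι → k} (hu : u ≠ 0) (hy : x *ᵥ y = u) (hxu : x *ᵥ u = 0) (w : ι → k) :
    ∃ c : k, x ^ q *ᵥ w = c • u := by
  obtain ⟨n, rfl⟩ := Nat.exists_eq_add_one_of_ne_zero hq
  obtain ⟨φ, hφ⟩ : ∃ φ : ι → k, φ ⬝ᵥ u = 1 := by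
    obtain ⟨i, hi⟩ := Function.ne_iff.1 hu
    exact ⟨Pi.single i (u i)⁻¹, by simpa using inv_mul_cancel₀ hi⟩
  set P : Matrix ι ι k := vecMulVec u φ with hP
  have hPP : P * P = P := by rw [hP, vecMulVec_mul_vecMulVec, hφ]; simp
  have hxP : x * P = 0 := by rw [hP, mul_vecMulVec, hxu, zero_vecMulVec]
  have hPu : P *ᵥ u = u := by rw [hP, vecMulVec_mulVec, hφ]; simp
  -- Conjugating `x` by `1 + s P` gives `x + s P x`; the torus degenerates at `s = -1`.
  have hmem : (1 - P) * x ∈ V := by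
    have := hV.quadratic_limit (A := x) (B := P * x) (C := 0) (s₀ := -1) fun s hs => by
      have hs' : 1 + s ≠ 0 := fun h => hs (by linear_combination h)
      obtain ⟨r, hr⟩ : ∃ r, s + r + s * r = 0 := ⟨-s / (1 + s), by field_simp; ring⟩
      have h1 : (1 + s • P) * (1 + r • P) = 1 := by
        have e1 : (1 + s • P) * (1 + r • P) = 1 + (s + r + s * r) • P := by
          simp only [add_mul, mul_add, one_mul, mul_one, smul_mul_assoc, mul_smul_comm, hPP]
          module
        rw [e1, hr]; simp
      have h3 := hst _ _ h1 x hxV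
      rwa [mul_assoc, mul_add, mul_smul_comm, hxP, smul_zero, add_zero, mul_one, add_mul, one_mul,
        smul_mul_assoc, ← add_zero (x + _), ← smul_zero (s ^ 2)] at h3
    have e : (1 - P) * x = x + (-1 : k) • (P * x) + (-1 : k) ^ 2 • (0 : Matrix ι ι k) := by
      rw [sub_mul, one_mul]; module
    rwa [e]
  have hpow : ∀ n, ((1 - P) * x) ^ (n + 1) = (1 - P) * x ^ (n + 1) := by
    intro n
    induction n with
    | zero => simp
    | succ n ih =>
      rw [pow_succ, ih, mul_assoc, ← mul_assoc (x ^ (n + 1)), mul_sub, pow_succ x n,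
        mul_assoc (x ^ n) x P, hxP, mul_zero, sub_zero, mul_one, ← pow_succ, ← pow_succ]
  have h0 : ((1 - P) * x) ^ (n + 1) = 0 := by
    by_contra h
    refine (hmin _ hmem h).not_gt (rank_mul_lt hu hy ?_)
    rw [sub_mulVec, one_mulVec, hPu, sub_self]
  rw [hpow] at h0
  refine ⟨φ ⬝ᵥ (x ^ (n + 1) *ᵥ w), ?_⟩
  have := congrArg (· *ᵥ w) h0
  simp only [← mulVec_mulVec, sub_mulVec, one_mulVec, zero_mulVec, hP, vecMulVec_mulVec] at this
  rw [op_smul_eq_smul] at this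
  exact sub_eq_zero.1 this

/-- The analogue for a group of isometries: the torus acts on the hyperbolic plane spanned by `u`
and a dual isotropic vector, and the conclusion holds on the hyperplane orthogonal to `u`. -/
theorem pow_mulVec_mem_span_of_minimal_form [Infinite k] (h2 : (2 : k) ≠ 0) {q : ℕ} (hq : q ≠ 0)
    {J : Matrix ι ι k} {ε : k} (hε : ε = 1 ∨ ε = -1) (hJ : Jᵀ = ε • J) (hJu : IsUnit J.det)
    {V : Set (Matrix ι ι k)} (hV : IsZariskiClosed V)
    (hst : ∀ g g' : Matrix ι ι k, g * g' = 1 → gᵀ * J * g = J → (ε = 1 → g.det = 1) →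
      ∀ x ∈ V, g * x * g' ∈ V)
    {x : Matrix ι ι k} (hxV : x ∈ V) (hx : xᵀ * J = -(J * x))
    (hmin : ∀ y ∈ V, y ^ q ≠ 0 → x.rank ≤ y.rank)
    {u y : ι → k} (hu : u ≠ 0) (hy : x *ᵥ y = u) (hxu : x *ᵥ u = 0) (w : ι → k)
    (hw : u ⬝ᵥ J *ᵥ w = 0) :
    ∃ c : k, x ^ q *ᵥ w = c • u := by
  obtain ⟨n, rfl⟩ := Nat.exists_eq_add_one_of_ne_zero hq
  have hεε : ε * ε = 1 := by rcases hε with rfl | rfl <;> simp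
  have hsymm := form_symm hε hJ
  have huu : u ⬝ᵥ J *ᵥ u = 0 := by
    have := pow_mulVec_form hx 1 y u
    rw [pow_one, hy, hxu] at this
    simpa using this
  obtain ⟨v, huv, hvv⟩ : ∃ v, u ⬝ᵥ J *ᵥ v = 1 ∧ v ⬝ᵥ J *ᵥ v = 0 := by
    obtain ⟨v, hv⟩ : ∃ v, u ⬝ᵥ J *ᵥ v = 1 := by
      obtain ⟨i, hi⟩ := Function.ne_iff.1 hu
      refine ⟨J⁻¹ *ᵥ Pi.single i (u i)⁻¹, ?_⟩
      rw [mulVec_mulVec, mul_nonsing_inv _ hJu, one_mulVec]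
      simpa using mul_inv_cancel₀ hi
    refine ⟨v + (-(v ⬝ᵥ J *ᵥ v) / 2) • u, ?_, ?_⟩
    · rw [mulVec_add, mulVec_smul, dotProduct_add, dotProduct_smul, huu, hv]; simp
    · have h1 := hsymm v v
      have h3 : v ⬝ᵥ J *ᵥ u = ε := by rw [hsymm, hv, mul_one]
      simp only [mulVec_add, mulVec_smul, dotProduct_add, add_dotProduct, dotProduct_smul,
        smul_dotProduct, huu, hv, h3, smul_eq_mul]
      field_simp
      linear_combination 2 * h1
  set φ := u ᵥ* J with hφ
  set ψ := v ᵥ* J with hψ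
  have hφv : φ ⬝ᵥ v = 1 := by rw [hφ, ← dotProduct_mulVec, huv]
  have hφu : φ ⬝ᵥ u = 0 := by rw [hφ, ← dotProduct_mulVec, huu]
  have hψv : ψ ⬝ᵥ v = 0 := by rw [hψ, ← dotProduct_mulVec, hvv]
  have hψu : ψ ⬝ᵥ u = ε := by rw [hψ, ← dotProduct_mulVec, hsymm, huv, mul_one]
  have hJv : J *ᵥ v = ε • ψ := by
    rw [hψ, ← mulVec_transpose, hJ, smul_mulVec, smul_smul, hεε, one_smul]
  have hJu' : J *ᵥ u = ε • φ := by
    rw [hφ, ← mulVec_transpose, hJ, smul_mulVec, smul_smul, hεε, one_smul]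
  set P : Matrix ι ι k := vecMulVec (ε • u) ψ with hP
  set Q : Matrix ι ι k := vecMulVec v φ with hQ
  have hPP : P * P = P := by
    rw [hP, vecMulVec_mul_vecMulVec, dotProduct_smul, hψu, smul_eq_mul, hεε]; simp
  have hQQ : Q * Q = Q := by rw [hQ, vecMulVec_mul_vecMulVec, hφv]; simp
  have hPQ : P * Q = 0 := by rw [hP, hQ, vecMulVec_mul_vecMulVec, hψv]; simp
  have hQP : Q * P = 0 := by
    rw [hP, hQ, vecMulVec_mul_vecMulVec, dotProduct_smul, hφu]; simp
  have hxP : x * P = 0 := by rw [hP, mul_vecMulVec, mulVec_smul, hxu]; simp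
  have hQx : Q * x = 0 := by
    have : J * x = -(xᵀ * J) := by rw [hx, neg_neg]
    rw [hQ, vecMulVec_mul, hφ, vecMul_vecMul, this, vecMul_neg, ← vecMul_vecMul, vecMul_transpose,
      hxu]
    simp
  have hPJ : Pᵀ * J = J * Q := by
    rw [hP, hQ, transpose_vecMulVec, vecMulVec_mul, mul_vecMulVec, hJv, smul_vecMul, ← hφ,
      vecMulVec_smul, smul_vecMulVec]
  have hQJ : Qᵀ * J = J * P := by
    rw [hP, hQ, transpose_vecMulVec, vecMulVec_mul, mul_vecMulVec, mulVec_smul, hJu', smul_smul,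
      hεε, one_smul]
  have hPu : P *ᵥ u = u := by
    rw [hP, vecMulVec_mulVec, hψu]; simp [smul_smul, hεε]
  -- The torus element scaling `u` by `1 + s` and `v` by `1 + r = (1 + s)⁻¹`; again `s → -1`.
  have hmem : (1 - P) * x * (1 - Q) ∈ V := by
    have := hV.quadratic_limit (A := x) (B := P * x + x * Q) (C := P * x * Q) (s₀ := -1)
      fun s hs => by
      have hs' : 1 + s ≠ 0 := fun h => hs (by linear_combination h)
      obtain ⟨r, hr⟩ : ∃ r, s + r + s * r = 0 := ⟨-s / (1 + s), by field_simp; ring⟩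
      have hinv : ∀ a b : k, a + b + a * b = 0 →
          (1 + a • P + b • Q) * (1 + b • P + a • Q) = 1 := by
        intro a b hab
        have e1 : (1 + a • P + b • Q) * (1 + b • P + a • Q)
            = 1 + (a + b + a * b) • P + (a + b + a * b) • Q := by
          simp only [add_mul, mul_add, one_mul, mul_one, smul_mul_assoc, mul_smul_comm, hPP, hQQ,
            hPQ, hQP, smul_zero]
          module
        rw [e1, hab]; simp
      have hiso : (1 + s • P + r • Q)ᵀ * J * (1 + s • P + r • Q) = J := by
        have : (1 + s • P + r • Q)ᵀ * J = J * (1 + r • P + s • Q) := by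
          simp only [transpose_add, transpose_smul, transpose_one, add_mul, mul_add,
            smul_mul_assoc, mul_smul_comm, hPJ, hQJ, one_mul, mul_one]
          module
        rw [this, Matrix.mul_assoc, hinv r s (by linear_combination hr), Matrix.mul_one]
      have hdet : (1 + s • P + r • Q).det = 1 := by
        have e1 : 1 + s • P + r • Q = (1 + s • P) * (1 + r • Q) := by
          simp only [add_mul, mul_add, one_mul, mul_one, smul_mul_assoc, mul_smul_comm, hPQ,
            smul_zero]
          module
        rw [e1, det_mul, hP, hQ, ← vecMulVec_smul, ← vecMulVec_smul, vecMulVec_eq Unit,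
          vecMulVec_eq Unit, det_one_add_replicateCol_mul_replicateRow,
          det_one_add_replicateCol_mul_replicateRow, smul_dotProduct, smul_dotProduct,
          dotProduct_smul, hψu, hφv,
          smul_eq_mul, smul_eq_mul, smul_eq_mul, hεε]
        linear_combination hr
      have h3 := hst _ _ (hinv s r hr) hiso (fun _ => hdet) x hxV
      have e2 : (1 + s • P + r • Q) * x * (1 + r • P + s • Q)
          = x + s • (P * x + x * Q) + s ^ 2 • (P * x * Q) := by
        have e3 : (1 + s • P + r • Q) * x = x + s • (P * x) := by
          rw [add_mul, add_mul, smul_mul_assoc, smul_mul_assoc, hQx, smul_zero, one_mul, add_zero]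
        rw [e3]
        simp only [add_mul, mul_add, mul_one, smul_mul_assoc, mul_smul_comm, hxP, mul_assoc,
          smul_zero, mul_zero]
        module
      rwa [e2] at h3
    have e : (1 - P) * x * (1 - Q)
        = x + (-1 : k) • (P * x + x * Q) + (-1 : k) ^ 2 • (P * x * Q) := by
      simp only [sub_mul, mul_sub, one_mul, mul_one]
      module
    rwa [e]
  have hpow : ∀ n, ((1 - P) * x * (1 - Q)) ^ (n + 1) = (1 - P) * x ^ (n + 1) * (1 - Q) := by
    have e : x * (1 - Q) * ((1 - P) * x) = x * x := by
      have : (1 - Q) * ((1 - P) * x) = x - P * x := by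
        simp only [sub_mul, mul_sub, one_mul, hQx, ← mul_assoc, hQP, zero_mul]
        module
      rw [mul_assoc, this, mul_sub, ← mul_assoc, hxP, zero_mul, sub_zero]
    intro n
    induction n with
    | zero => simp
    | succ n ih =>
      rw [pow_succ, ih, pow_succ x n]
      calc (1 - P) * (x ^ n * x) * (1 - Q) * ((1 - P) * x * (1 - Q))
          = (1 - P) * x ^ n * (x * (1 - Q) * ((1 - P) * x)) * (1 - Q) := by
            simp only [mul_assoc]
        _ = (1 - P) * x ^ (n + 1 + 1) * (1 - Q) := by
            rw [e, pow_succ, pow_succ]; simp only [mul_assoc]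
  have h0 : ((1 - P) * x * (1 - Q)) ^ (n + 1) = 0 := by
    by_contra h
    refine (hmin _ hmem h).not_gt ((rank_mul_le_left _ _).trans_lt (rank_mul_lt hu hy ?_))
    rw [sub_mulVec, one_mulVec, hPu, sub_self]
  rw [hpow] at h0
  refine ⟨ε * (ψ ⬝ᵥ (x ^ (n + 1) *ᵥ w)), ?_⟩
  have hQw : Q *ᵥ w = 0 := by
    rw [hQ, vecMulVec_mulVec, hφ, ← dotProduct_mulVec, hw]; simp
  have := congrArg (· *ᵥ w) h0
  simp only [← mulVec_mulVec, sub_mulVec, one_mulVec, zero_mulVec, hQw, sub_zero] at this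
  refine (sub_eq_zero.1 this).trans ?_
  rw [hP, vecMulVec_mulVec, op_smul_eq_smul, smul_smul, mul_comm]

end Degenerations

/-! ### Frames, and the case of the general linear group -/

section Frames

variable {k : Type*} [Field k] {ι α : Type*} [Fintype α]

theorem exists_mulVec_ne_zero [DecidableEq α] {x : Matrix ι α k} (hx : x ≠ 0) :
    ∃ u, x *ᵥ u ≠ 0 := by
  by_contra! h
  exact hx (Matrix.toLin'.injective (LinearMap.ext fun u => by simpa using h u))

variable [DecidableEq α]

theorem frame_mul_frame [Fintype ι] {S : Matrix ι α k} {R : Matrix α ι k} (hRS : R * S = 1)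
    (A B : Matrix α α k) : S * A * R * (S * B * R) = S * (A * B) * R := by
  calc S * A * R * (S * B * R) = S * A * (R * S) * B * R := by simp only [Matrix.mul_assoc]
    _ = S * (A * B) * R := by rw [hRS, Matrix.mul_one]; simp only [Matrix.mul_assoc]

variable [DecidableEq ι]

/-- The matrix acting as `g` on the image of `S` and as the identity on the kernel of `R`, for
matrices with `R * S = 1`. -/
def frameExtend (S : Matrix ι α k) (R : Matrix α ι k) (g : Matrix α α k) : Matrix ι ι k :=
  1 + S * ((g - 1) * R)

theorem frameExtend_eq (S : Matrix ι α k) (R : Matrix α ι k) (g : Matrix α α k) :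
    frameExtend S R g = S * g * R + (1 - S * R) := by
  rw [frameExtend, Matrix.sub_mul, Matrix.mul_sub, Matrix.one_mul, ← Matrix.mul_assoc]
  abel

variable [Fintype ι]

theorem frame_pow {S : Matrix ι α k} {R : Matrix α ι k} (hRS : R * S = 1)
    (A : Matrix α α k) {n : ℕ} (hn : n ≠ 0) : (S * A * R) ^ n = S * A ^ n * R := by
  obtain ⟨n, rfl⟩ := Nat.exists_eq_add_one_of_ne_zero hn
  induction n with
  | zero => simp
  | succ n ih => rw [pow_succ, ih (by omega), frame_mul_frame hRS, ← pow_succ]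

theorem IsDeformedTriple.frame {S : Matrix ι α k} {R : Matrix α ι k} (hRS : R * S = 1) {p : ℕ}
    (hp : p ≠ 0) {c : k} {e h f : Matrix α α k} (H : IsDeformedTriple p c e h f) :
    IsDeformedTriple p c (S * e * R) (S * h * R) (S * f * R) := by
  constructor
  · rw [frame_mul_frame hRS, frame_mul_frame hRS, ← Matrix.sub_mul, ← Matrix.mul_sub,
      H.weight_raising, Matrix.mul_smul, Matrix.smul_mul]
  · rw [frame_mul_frame hRS, frame_mul_frame hRS, ← Matrix.sub_mul, ← Matrix.mul_sub,
      H.weight_lowering, Matrix.mul_smul, Matrix.smul_mul]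
  · rw [frame_mul_frame hRS, frame_mul_frame hRS, ← Matrix.sub_mul, ← Matrix.mul_sub,
      H.raising_lowering]
  · rw [frame_pow hRS _ hp, frame_pow hRS _ hp, ← Matrix.sub_mul, ← Matrix.mul_sub,
      H.sub_pow, Matrix.mul_smul, Matrix.smul_mul]

theorem det_frameExtend {S : Matrix ι α k} {R : Matrix α ι k} (hRS : R * S = 1)
    (g : Matrix α α k) : (frameExtend S R g).det = g.det := by
  rw [frameExtend, det_one_add_mul_comm, Matrix.mul_assoc, hRS, Matrix.mul_one,
    add_sub_cancel]

theorem frameExtend_mul_frame {S : Matrix ι α k} {R : Matrix α ι k} (hRS : R * S = 1)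
    {e f g : Matrix α α k} (hg : g * e = f * g) :
    frameExtend S R g * (S * e * R) = S * f * R * frameExtend S R g := by
  have h1 : (1 - S * R) * (S * e * R) = 0 := by
    have : (1 - S * R) * (S * e * R) = S * e * R - S * (R * S) * e * R := by
      simp only [Matrix.sub_mul, Matrix.one_mul, Matrix.mul_assoc]
    rw [this, hRS, Matrix.mul_one, sub_self]
  have h2 : S * f * R * (1 - S * R) = 0 := by
    have : S * f * R * (1 - S * R) = S * f * R - S * f * (R * S) * R := by
      simp only [Matrix.mul_sub, Matrix.mul_one, Matrix.mul_assoc]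
    rw [this, hRS, Matrix.mul_one, sub_self]
  rw [frameExtend_eq, add_mul, mul_add, h1, h2, frame_mul_frame hRS, frame_mul_frame hRS, hg]

theorem frameExtend_isometry {S : Matrix ι α k} {R : Matrix α ι k} (hRS : R * S = 1)
    {J : Matrix ι ι k} {K : Matrix α α k} (h1 : Sᵀ * J = K * R) (h2 : J * S = Rᵀ * K)
    {g : Matrix α α k} (hg : gᵀ * K * g = K) :
    (frameExtend S R g)ᵀ * J * frameExtend S R g = J := by
  have hT : (frameExtend S R g)ᵀ * J = Rᵀ * gᵀ * K * R + (J - Rᵀ * K * R) := by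
    rw [frameExtend_eq]
    simp only [transpose_add, transpose_sub, transpose_mul, transpose_one, Matrix.add_mul,
      Matrix.sub_mul, Matrix.one_mul, Matrix.mul_assoc, h1]
  have e1 : Rᵀ * gᵀ * K * R * (S * g * R) = Rᵀ * K * R := by
    calc Rᵀ * gᵀ * K * R * (S * g * R) = Rᵀ * (gᵀ * K * (R * S) * g) * R := by
          simp only [Matrix.mul_assoc]
      _ = Rᵀ * K * R := by rw [hRS, Matrix.mul_one, hg]
  have e2 : ∀ A : Matrix ι α k, A * R * (1 - S * R) = 0 := by
    intro A
    calc A * R * (1 - S * R) = A * R - A * (R * S) * R := by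
          simp only [Matrix.mul_sub, Matrix.mul_one, Matrix.mul_assoc]
      _ = 0 := by rw [hRS, Matrix.mul_one, sub_self]
  have e3 : (J - Rᵀ * K * R) * (S * g * R) = 0 := by
    calc (J - Rᵀ * K * R) * (S * g * R) = J * S * g * R - Rᵀ * K * (R * S) * g * R := by
          simp only [Matrix.sub_mul, Matrix.mul_assoc]
      _ = 0 := by rw [hRS, Matrix.mul_one, h2, sub_self]
  have e4 : J * (1 - S * R) = J - Rᵀ * K * R := by
    rw [Matrix.mul_sub, Matrix.mul_one, ← Matrix.mul_assoc, h2]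
  rw [hT, frameExtend_eq, Matrix.add_mul, Matrix.mul_add, Matrix.mul_add, e1, e2, e3,
    Matrix.sub_mul, e2, e4]
  abel

/-- A nilpotent matrix that restricts to `e` on the image of `S` and preserves the complement
`ker R` vanishes on that complement as soon as the complement contains no nonzero vector in the
image and the kernel of `x`. -/
theorem eq_frame_of_forall {S : Matrix ι α k} {R : Matrix α ι k} {x : Matrix ι ι k}
    {e : Matrix α α k} (hx : IsNilpotent x) (hxS : x * S = S * e)
    (hRS : R * S = 1) (hRx : R * x = e * R)
    (hker : ∀ u y, x *ᵥ y = u → x *ᵥ u = 0 → R *ᵥ u = 0 → u = 0) : x = S * e * R := by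
  rw [← hxS]
  by_contra hne
  obtain ⟨w, hw⟩ : ∃ w, x *ᵥ (w - S *ᵥ (R *ᵥ w)) ≠ 0 := by
    by_contra! h
    refine hne (Matrix.toLin'.injective (LinearMap.ext fun w => ?_))
    have := h w
    rw [mulVec_sub, sub_eq_zero, mulVec_mulVec, mulVec_mulVec] at this
    simpa [Matrix.mul_assoc] using this
  set w' := w - S *ᵥ (R *ᵥ w) with hw'
  have hRw : R *ᵥ w' = 0 := by
    rw [hw', mulVec_sub, mulVec_mulVec, hRS, one_mulVec, sub_self]
  have hRj : ∀ j, R *ᵥ (x ^ j *ᵥ w') = 0 := by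
    intro j
    induction j with
    | zero => simpa using hRw
    | succ j ih => rw [pow_succ', ← mulVec_mulVec, mulVec_mulVec _ R, hRx, ← mulVec_mulVec, ih,
        mulVec_zero]
  have hstep : ∀ j, 1 ≤ j → x ^ j *ᵥ w' ≠ 0 := by
    intro j hj
    by_contra h0
    classical
    have hex : ∃ j, x ^ j *ᵥ w' = 0 := ⟨j, h0⟩
    have hspec := Nat.find_spec hex
    have hmin := fun m => Nat.find_min hex (m := m)
    set n := Nat.find hex
    have hn0 : n ≠ 0 := by
      intro h
      rw [h, pow_zero, one_mulVec] at hspec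
      exact hw (by rw [hspec, mulVec_zero])
    have hn1 : n ≠ 1 := by
      intro h
      rw [h, pow_one] at hspec
      exact hw hspec
    obtain ⟨m, hm⟩ : ∃ m, n = m + 2 := ⟨n - 2, by omega⟩
    refine hmin (m + 1) (by omega) (hker _ (x ^ m *ᵥ w') ?_ ?_ (hRj _))
    · rw [mulVec_mulVec, ← pow_succ']
    · rw [mulVec_mulVec, ← pow_succ', ← hspec, hm]
  obtain ⟨n, hn⟩ := hx
  refine hstep (n + 1) (by omega) ?_
  rw [pow_succ, hn]; simp

/-- A retraction onto the span of a full chain `x ^ (N - 1) u, …, u` that is equivariant for `x`;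
its kernel is an `x`-stable complement. -/
theorem exists_retraction {x : Matrix ι ι k} {N : ℕ} (hx : x ^ N = 0) {u : ι → k}
    (hu : x ^ (N - 1) *ᵥ u ≠ 0) :
    ∃ R : Matrix (Fin N) ι k, R * cyclicFrame x u N = 1 ∧ R * x = jordanBlock k N * R := by
  obtain ⟨φ, hφ⟩ : ∃ φ : ι → k, φ ⬝ᵥ (x ^ (N - 1) *ᵥ u) = 1 := by
    obtain ⟨i, hi⟩ := Function.ne_iff.1 hu
    exact ⟨Pi.single i ((x ^ (N - 1) *ᵥ u) i)⁻¹, by simpa using inv_mul_cancel₀ hi⟩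
  set S := cyclicFrame x u N with hS
  have hxS : x * S = S * jordanBlock k N := mul_cyclicFrame (by rw [hx, zero_mulVec])
  set R₀ : Matrix (Fin N) ι k := of fun j => φ ᵥ* x ^ (j : ℕ) with hR₀
  have hR₀x : R₀ * x = jordanBlock k N * R₀ := by
    ext i j
    have h1 : (R₀ * x) i j = (φ ᵥ* x ^ ((i : ℕ) + 1)) j := by
      rw [pow_succ, ← vecMul_vecMul]; rfl
    rw [h1, jordanBlock_mul_apply]
    split_ifs with h
    · rfl
    · have : (i : ℕ) + 1 = N := by have := i.2; omega
      rw [this, hx, vecMul_zero]; rfl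
  have hB : ∀ i j, (R₀ * S) i j = φ ⬝ᵥ (x ^ ((i : ℕ) + (N - 1 - j)) *ᵥ u) := by
    intro i j
    rw [pow_add, ← mulVec_mulVec, dotProduct_mulVec]
    rfl
  have hdet : (R₀ * S).det = 1 := by
    rw [det_of_isUpperTriangular]
    · refine Finset.prod_eq_one fun i _ => ?_
      have : (i : ℕ) + (N - 1 - i) = N - 1 := by have := i.2; omega
      rw [hB, this, hφ]
    · intro i j hij
      have hij' : (j : ℕ) < i := hij
      obtain ⟨d, hd⟩ : ∃ d, (i : ℕ) + (N - 1 - j) = d + N :=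
        ⟨i + (N - 1 - j) - N, by have := i.2; omega⟩
      rw [hB, hd, pow_add, hx, mul_zero, zero_mulVec, dotProduct_zero]
  have hu' : IsUnit (R₀ * S).det := by rw [hdet]; exact isUnit_one
  have hcomm : R₀ * S * jordanBlock k N = jordanBlock k N * (R₀ * S) := by
    rw [Matrix.mul_assoc, ← hxS, ← Matrix.mul_assoc, hR₀x, Matrix.mul_assoc]
  refine ⟨(R₀ * S)⁻¹ * R₀, ?_, ?_⟩
  · rw [Matrix.mul_assoc, nonsing_inv_mul _ hu']
  · have : (R₀ * S)⁻¹ * jordanBlock k N = jordanBlock k N * (R₀ * S)⁻¹ := by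
      calc (R₀ * S)⁻¹ * jordanBlock k N
          = (R₀ * S)⁻¹ * (jordanBlock k N * (R₀ * S)) * (R₀ * S)⁻¹ := by
            rw [Matrix.mul_assoc, Matrix.mul_assoc, mul_nonsing_inv _ hu', Matrix.mul_one]
        _ = jordanBlock k N * (R₀ * S)⁻¹ := by
            rw [← hcomm, ← Matrix.mul_assoc, nonsing_inv_mul _ hu', Matrix.one_mul]
    rw [Matrix.mul_assoc, hR₀x, ← Matrix.mul_assoc, this, Matrix.mul_assoc]

theorem exists_minimal_rank {q : ℕ} {V : Set (Matrix ι ι k)} (h : ∃ x ∈ V, x ^ q ≠ 0) :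
    ∃ x ∈ V, x ^ q ≠ 0 ∧ ∀ y ∈ V, y ^ q ≠ 0 → x.rank ≤ y.rank := by
  obtain ⟨x, hx, hxq⟩ := h
  obtain ⟨m, hm, hmin⟩ := WellFounded.has_min (InvImage.wf Matrix.rank wellFounded_lt)
    {y | y ∈ V ∧ y ^ q ≠ 0} ⟨x, hx, hxq⟩
  exact ⟨m, hm.1, hm.2, fun y hy hyq => not_lt.1 (hmin y ⟨hy, hyq⟩)⟩

theorem exists_pow_succ_eq_zero {x : Matrix ι ι k} (hx : IsNilpotent x) {q : ℕ}
    (hq : x ^ q ≠ 0) : ∃ M, q ≤ M ∧ x ^ (M + 1) = 0 ∧ x ^ M ≠ 0 := by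
  classical
  have hspec := Nat.find_spec hx
  have hmin := fun m => Nat.find_min hx (m := m)
  set n := Nat.find hx
  have hqn : q < n := by
    by_contra h
    exact hq (pow_eq_zero_of_le (not_lt.1 h) hspec)
  exact ⟨n - 1, by omega, by rwa [Nat.sub_add_cancel (by omega)], hmin _ (by omega)⟩

theorem isUnit_det_of_isometry {K g : Matrix α α k} (hK : IsUnit K.det) (hg : gᵀ * K * g = K) :
    IsUnit g.det := by
  rw [← hg, det_mul] at hK
  exact isUnit_of_mul_isUnit_right hK

theorem frameExtend_mem {V : Set (Matrix ι ι k)} {S : Matrix ι α k} {R : Matrix α ι k}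
    (hRS : R * S = 1) {e f g : Matrix α α k} (hg : g * e = f * g) (hgu : IsUnit g.det)
    (hst : ∀ g' : Matrix ι ι k, frameExtend S R g * g' = 1 →
      ∀ x ∈ V, frameExtend S R g * x * g' ∈ V)
    (he : S * e * R ∈ V) : S * f * R ∈ V := by
  have hu : IsUnit (frameExtend S R g).det := by rwa [det_frameExtend hRS]
  have := hst _ (mul_nonsing_inv _ hu) _ he
  rwa [frameExtend_mul_frame hRS hg, Matrix.mul_assoc _ _ (frameExtend S R g)⁻¹,
    mul_nonsing_inv _ hu, Matrix.mul_one] at this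

theorem pow_mul_frame {S : Matrix ι α k} {x : Matrix ι ι k} {e : Matrix α α k}
    (hxS : x * S = S * e) (n : ℕ) : x ^ n * S = S * e ^ n := by
  induction n with
  | zero => simp
  | succ n ih => rw [pow_succ', Matrix.mul_assoc, ih, ← Matrix.mul_assoc, hxS, Matrix.mul_assoc,
      ← pow_succ']

/-- A vector of `ker R` cannot be proportional to a nonzero vector of the image of `S`. -/
theorem pow_mulVec_frame_ne_smul {S : Matrix ι α k} {R : Matrix α ι k} {x : Matrix ι ι k}
    {e : Matrix α α k} (hxS : x * S = S * e) (hRS : R * S = 1) {n : ℕ} {z : α → k}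
    (hz : e ^ n *ᵥ z ≠ 0) {u : ι → k} (hu : R *ᵥ u = 0) (c : k) :
    x ^ n *ᵥ (S *ᵥ z) ≠ c • u := by
  intro h
  have h1 := congrArg (R *ᵥ ·) h
  simp only [mulVec_mulVec, mulVec_smul, hu, smul_zero] at h1
  rw [← Matrix.mul_assoc, Matrix.mul_assoc R, pow_mul_frame hxS, ← Matrix.mul_assoc, hRS,
    Matrix.one_mul] at h1
  exact hz h1

/-- A `GL`-stable closed set of nilpotent matrices not contained in `{x | x ^ p = 0}` contains an
element that belongs to deformed triples for all nonzero parameters. -/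
theorem exists_deformed_triples_of_stable [IsAlgClosed k] {p : ℕ} [CharP k p] (hp : 2 < p)
    {V : Set (Matrix ι ι k)} (hV : IsZariskiClosed V)
    (hst : ∀ g g' : Matrix ι ι k, g * g' = 1 → ∀ x ∈ V, g * x * g' ∈ V)
    (hnil : ∀ x ∈ V, IsNilpotent x) (h : ∃ x ∈ V, x ^ p ≠ 0) :
    ∃ x ∈ V, x ^ p ≠ 0 ∧ ∀ c : k, c ≠ 0 → ∃ h, ∃ f ∈ V, IsDeformedTriple p c x h f := by
  have : Infinite k := IsAlgClosed.instInfinite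
  obtain ⟨x, hxV, hxp, hmin⟩ := exists_minimal_rank h
  refine ⟨x, hxV, hxp, fun c hc => ?_⟩
  obtain ⟨M, hpM, hM1, hM⟩ := exists_pow_succ_eq_zero (hnil x hxV) hxp
  obtain ⟨u, hu⟩ := exists_mulVec_ne_zero hM
  have hstar := fun {u y : ι → k} => pow_mulVec_mem_span_of_minimal (by omega : p ≠ 0) hV hst hxV
    hmin (u := u) (y := y)
  obtain rfl : M = p := by
    obtain ⟨c, hc⟩ := hstar hu (y := x ^ (M - 1) *ᵥ u)
      (by rw [mulVec_mulVec, mul_pow_sub_one (by omega)])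
      (by rw [mulVec_mulVec, ← pow_succ', hM1, zero_mulVec]) u
    by_contra hne
    have h1 := congrArg (fun v => x ^ (M - p) *ᵥ v) hc
    have h2 : M - p + M = M + 1 + (M - p - 1) := by omega
    simp only [mulVec_smul, mulVec_mulVec, ← pow_add] at h1
    rw [Nat.sub_add_cancel hpM, h2, pow_add, hM1, zero_mul, zero_mulVec, smul_zero] at h1
    exact hu h1
  obtain ⟨R, hRS, hRx⟩ := exists_retraction hM1 (u := u) (by simpa using hu)
  set S := cyclicFrame x u (M + 1)
  have hxS : x * S = S * jordanBlock k (M + 1) := mul_cyclicFrame (by rw [hM1, zero_mulVec])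
  have hxe : x = S * jordanBlock k (M + 1) * R := by
    refine eq_frame_of_forall (hnil x hxV) hxS hRS hRx fun u' y hy hxu hRu => ?_
    by_contra hu'
    obtain ⟨z, hz⟩ := exists_mulVec_ne_zero
      (jordanBlock_pow_ne_zero (k := k) (show M < M + 1 by omega))
    obtain ⟨c, hc⟩ := hstar hu' hy hxu (S *ᵥ z)
    exact pow_mulVec_frame_ne_smul hxS hRS hz hRu c hc
  obtain ⟨h, f, g, hT, hg, -, hge⟩ := exists_deformed_triple hp (Or.inl rfl) hc
  have hgu := isUnit_det_of_isometry (isUnit_det_antidiagForm _) hg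
  refine ⟨S * h * R, S * f * R, frameExtend_mem hRS hge hgu (fun g' h => hst _ g' h)
    (hxe ▸ hxV), ?_⟩
  have := hT.frame hRS (by omega)
  rwa [← hxe] at this

end Frames

/-! ### Groups of isometries -/

section IsometryGroups

variable {k : Type*} [Field k] {ι : Type*} [Fintype ι]

/-- The retraction adjoint to a frame with nondegenerate Gram matrix `K`. -/
theorem exists_adjoint_retraction {α : Type*} [Fintype α] [DecidableEq α] {J : Matrix ι ι k}
    {ε : k} (hε : ε = 1 ∨ ε = -1) (hJ : Jᵀ = ε • J) {x : Matrix ι ι k} (hx : xᵀ * J = -(J * x))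
    {S : Matrix ι α k} {K e : Matrix α α k} (hK : IsUnit K.det) (hS : Sᵀ * J * S = K)
    (hxS : x * S = S * e) :
    ∃ R : Matrix α ι k, R * S = 1 ∧ R * x = e * R ∧ Sᵀ * J = K * R ∧ J * S = Rᵀ * K := by
  have hε0 : ε ≠ 0 := by rcases hε with rfl | rfl <;> simp
  have h1 : Sᵀ * J = K * (K⁻¹ * (Sᵀ * J)) := by
    rw [← Matrix.mul_assoc, mul_nonsing_inv _ hK, Matrix.one_mul]
  have hKT : Kᵀ = ε • K := by
    rw [← hS, transpose_mul, transpose_mul, transpose_transpose, hJ, Matrix.smul_mul,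
      Matrix.mul_smul, Matrix.mul_assoc]
  have heK : eᵀ * K = -(K * e) := by
    calc eᵀ * K = (S * e)ᵀ * J * S := by rw [← hS, transpose_mul]; simp only [Matrix.mul_assoc]
      _ = Sᵀ * (xᵀ * J) * S := by rw [← hxS, transpose_mul]; simp only [Matrix.mul_assoc]
      _ = -(Sᵀ * J * (x * S)) := by
        rw [hx, Matrix.mul_neg, Matrix.neg_mul]; simp only [Matrix.mul_assoc]
      _ = -(K * e) := by rw [hxS, ← Matrix.mul_assoc, hS]
  refine ⟨K⁻¹ * (Sᵀ * J), ?_, ?_, h1, ?_⟩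
  · rw [Matrix.mul_assoc, hS, nonsing_inv_mul _ hK]
  · have h3 : K * (K⁻¹ * (Sᵀ * J) * x) = K * (e * (K⁻¹ * (Sᵀ * J))) := by
      calc K * (K⁻¹ * (Sᵀ * J) * x) = Sᵀ * (J * x) := by
            rw [← Matrix.mul_assoc, ← h1, Matrix.mul_assoc]
        _ = -((x * S)ᵀ * J) := by
            rw [transpose_mul, Matrix.mul_assoc, hx, Matrix.mul_neg, neg_neg]
        _ = -(eᵀ * (K * (K⁻¹ * (Sᵀ * J)))) := by
            rw [hxS, transpose_mul, Matrix.mul_assoc, ← h1]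
        _ = K * (e * (K⁻¹ * (Sᵀ * J))) := by
            rw [← Matrix.mul_assoc eᵀ, heK, Matrix.neg_mul, neg_neg, Matrix.mul_assoc]
    have h4 := congrArg (K⁻¹ * ·) h3
    simpa only [← Matrix.mul_assoc, nonsing_inv_mul _ hK, Matrix.one_mul] using h4
  · have h3 := congrArg transpose h1
    rw [transpose_mul, transpose_transpose, hJ, transpose_mul K, hKT, Matrix.smul_mul,
      Matrix.mul_smul] at h3
    exact smul_right_injective _ hε0 h3

variable [DecidableEq ι]

/-- The form `(a, b) ↦ ⟨a, x ^ i b⟩` attached to a skew-adjoint `x` has sign `ε (-1) ^ i`. -/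
theorem form_pow_symm {J : Matrix ι ι k} {ε : k} (hε : ε = 1 ∨ ε = -1) (hJ : Jᵀ = ε • J)
    {x : Matrix ι ι k} (hx : xᵀ * J = -(J * x)) (i : ℕ) (a b : ι → k) :
    a ⬝ᵥ J *ᵥ (x ^ i *ᵥ b) = ε * (-1) ^ i * (b ⬝ᵥ J *ᵥ (x ^ i *ᵥ a)) := by
  rw [form_symm hε hJ, pow_mulVec_form hx, mul_assoc]

/-- Adding multiples of the `x ^ s v` with `s ≥ 1` to `u` makes `u` orthogonal to all `x ^ i u`
with `i < M`, where `x ^ (M + 1) = 0`, without changing `x ^ M u`. -/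
theorem exists_orthogonal_powers (h2 : (2 : k) ≠ 0) {J : Matrix ι ι k} {ε : k}
    (hε : ε = 1 ∨ ε = -1) (hJ : Jᵀ = ε • J) {x : Matrix ι ι k} (hx : xᵀ * J = -(J * x)) {M : ℕ}
    (hM : x ^ (M + 1) = 0) {u v : ι → k} (huv : v ⬝ᵥ J *ᵥ (x ^ M *ᵥ u) ≠ 0) :
    ∃ u', x ^ M *ᵥ u' = x ^ M *ᵥ u ∧ ∀ i < M, u' ⬝ᵥ J *ᵥ (x ^ i *ᵥ u') = 0 := by
  have key : ∀ d, ∃ u', x ^ M *ᵥ u' = x ^ M *ᵥ u ∧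
      ∀ i < M, M ≤ i + d → u' ⬝ᵥ J *ᵥ (x ^ i *ᵥ u') = 0 := by
    intro d
    induction d with
    | zero => exact ⟨u, rfl, fun i h1 h2 => absurd h2 (by omega)⟩
    | succ s ih =>
      obtain ⟨u', hu', ho⟩ := ih
      by_cases hs : M < s + 1
      · exact ⟨u', hu', fun i hi _ => ho i hi (by omega)⟩
      obtain ⟨j, rfl⟩ : ∃ j, M = j + (s + 1) := ⟨M - (s + 1), by omega⟩
      set β := v ⬝ᵥ J *ᵥ (x ^ (j + (s + 1)) *ᵥ u) with hβ
      set b := u' ⬝ᵥ J *ᵥ (x ^ j *ᵥ u') with hb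
      -- With this coefficient the two cross terms cancel `b`; when their signs differ, `b = 0`.
      set a := -b / (2 * β * (-1) ^ (s + 1)) with ha
      have hzero : ∀ n, j + (s + 1) < n → x ^ n = 0 := fun n hn => pow_eq_zero_of_le hn hM
      have hexp : ∀ i, (u' + a • (x ^ (s + 1) *ᵥ v)) ⬝ᵥ J *ᵥ
          (x ^ i *ᵥ (u' + a • (x ^ (s + 1) *ᵥ v))) =
          u' ⬝ᵥ J *ᵥ (x ^ i *ᵥ u') + a * (u' ⬝ᵥ J *ᵥ (x ^ (i + (s + 1)) *ᵥ v)) +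
          a * ((-1) ^ (s + 1) * (v ⬝ᵥ J *ᵥ (x ^ (i + (s + 1)) *ᵥ u'))) +
          a * a * ((-1) ^ (s + 1) * (v ⬝ᵥ J *ᵥ (x ^ (i + (s + 1) + (s + 1)) *ᵥ v))) := by
        intro i
        have e1 : ∀ w : ι → k, x ^ i *ᵥ (x ^ (s + 1) *ᵥ w) = x ^ (i + (s + 1)) *ᵥ w :=
          fun w => by rw [mulVec_mulVec, ← pow_add]
        have e2 : ∀ (m : ℕ) (w : ι → k), (x ^ (s + 1) *ᵥ v) ⬝ᵥ J *ᵥ (x ^ m *ᵥ w) =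
            (-1) ^ (s + 1) * (v ⬝ᵥ J *ᵥ (x ^ (m + (s + 1)) *ᵥ w)) := fun m w => by
          rw [pow_mulVec_form hx, mulVec_mulVec w, ← pow_add, add_comm (s + 1) m]
        simp only [mulVec_add, mulVec_smul, dotProduct_add, add_dotProduct, dotProduct_smul,
          smul_dotProduct, smul_eq_mul, e1, e2]
        ring
      refine ⟨u' + a • (x ^ (s + 1) *ᵥ v), ?_, fun i hi hid => ?_⟩
      · rw [mulVec_add, mulVec_smul, mulVec_mulVec, ← pow_add,
          hzero (j + (s + 1) + (s + 1)) (by omega), zero_mulVec,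
          smul_zero, add_zero, hu']
      rw [hexp]
      rcases eq_or_ne i j with rfl | hij
      · rw [hzero (i + (s + 1) + (s + 1)) (by omega), form_pow_symm hε hJ hx (i + (s + 1)) u' v,
          hu', ← hβ, ← hb, zero_mulVec, mulVec_zero, dotProduct_zero]
        have hb' : b = ε * (-1) ^ i * b := form_pow_symm hε hJ hx i u' u'
        have h1 : (-1 : k) ^ (s + 1) * (-1) ^ (s + 1) = 1 := by rw [← mul_pow]; simp
        have h3 : (-1 : k) ^ i * (-1) ^ i = 1 := by rw [← mul_pow]; simp
        have h4 : (ε * (-1) ^ i = 1) ∨ b = 0 := by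
          by_cases h : ε * (-1) ^ i = 1
          · exact Or.inl h
          · right
            by_contra hb0
            exact h (mul_right_cancel₀ hb0 (by rw [one_mul]; exact hb'.symm))
        rcases h4 with h4 | h4
        · rw [pow_add, ← mul_assoc ε, h4, ha]
          have h5 : (-1 : k) ^ (s + 1) ≠ 0 := pow_ne_zero _ (neg_ne_zero.2 one_ne_zero)
          field_simp
          ring
        · rw [ha, h4]; simp
      · have := ho i hi (by omega)
        rw [this, hzero (i + (s + 1)) (by omega), hzero (i + (s + 1) + (s + 1)) (by omega)]
        simp
  obtain ⟨u', h1, h3⟩ := key M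
  exact ⟨u', h1, fun i hi => h3 i hi (by omega)⟩

/-- The block-diagonal action of a deformed triple on a space and its dual. -/
theorem IsDeformedTriple.dualSum {α : Type*} [Fintype α] [DecidableEq α] {p : ℕ} (hp : Odd p)
    {c : k} {e h f : Matrix α α k} (H : IsDeformedTriple p c e h f) :
    IsDeformedTriple p c (fromBlocks e 0 0 (-eᵀ)) (fromBlocks h 0 0 (-hᵀ))
      (fromBlocks f 0 0 (-fᵀ)) := by
  have hsub : ∀ A B C D : Matrix α α k,
      fromBlocks A 0 0 B - fromBlocks C 0 0 D = fromBlocks (A - C) 0 0 (B - D) := by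
    intro A B C D
    rw [sub_eq_add_neg, fromBlocks_neg, fromBlocks_add]
    simp [sub_eq_add_neg]
  have hT : ∀ A B : Matrix α α k, -Aᵀ * -Bᵀ - -Bᵀ * -Aᵀ = -(A * B - B * A)ᵀ := by
    intro A B
    rw [transpose_sub, transpose_mul, transpose_mul, neg_mul_neg, neg_mul_neg, neg_sub]
  constructor
  · simp only [fromBlocks_multiply, Matrix.mul_zero, Matrix.zero_mul, add_zero, zero_add, hsub,
      hT, H.weight_raising, fromBlocks_smul, smul_zero, transpose_smul, smul_neg]
  · simp only [fromBlocks_multiply, Matrix.mul_zero, Matrix.zero_mul, add_zero, zero_add, hsub,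
      hT, H.weight_lowering, fromBlocks_smul, smul_zero, transpose_smul, smul_neg]
  · simp only [fromBlocks_multiply, Matrix.mul_zero, Matrix.zero_mul, add_zero, zero_add, hsub,
      hT, H.raising_lowering]
  · rw [fromBlocks_diagonal_pow, fromBlocks_diagonal_pow, hsub, hp.neg_pow, hp.neg_pow,
      ← transpose_pow, ← transpose_pow, fromBlocks_smul, H.sub_pow, smul_zero, smul_neg,
      ← transpose_smul, ← H.sub_pow, transpose_sub]
    congr 1
    abel

/-- The standard hyperbolic symmetric form. -/
def hyperbolicForm (k : Type*) [Field k] (α : Type*) [DecidableEq α] :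
    Matrix (α ⊕ α) (α ⊕ α) k :=
  fromBlocks 0 1 1 0

theorem isUnit_det_hyperbolicForm (α : Type*) [Fintype α] [DecidableEq α] :
    IsUnit (hyperbolicForm k α).det := by
  rw [← isUnit_iff_isUnit_det]
  refine IsUnit.of_mul_eq_one (hyperbolicForm k α) ?_
  rw [hyperbolicForm, fromBlocks_multiply]
  simp

/-- A Jordan chain of `x` orthogonal to itself, with respect to a symmetric form, is one half of a
hyperbolic pair of chains. -/
theorem exists_hyperbolic_frame (h2 : (2 : k) ≠ 0) {J : Matrix ι ι k} (hJ : Jᵀ = J)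
    (hJu : IsUnit J.det) {x : Matrix ι ι k} (hx : xᵀ * J = -(J * x)) {α : Type*} [Fintype α]
    [DecidableEq α] {S : Matrix ι α k} {R : Matrix α ι k} {e : Matrix α α k} (hRS : R * S = 1)
    (hxS : x * S = S * e) (hRx : R * x = e * R) (hS : Sᵀ * J * S = 0) :
    ∃ S' : Matrix ι (α ⊕ α) k, S'ᵀ * J * S' = hyperbolicForm k α ∧
      x * S' = S' * fromBlocks e 0 0 (-eᵀ) := by
  obtain ⟨T₀, hT₀⟩ : ∃ T₀ : Matrix ι α k, T₀ = J⁻¹ * Rᵀ := ⟨_, rfl⟩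
  have hJT₀ : J * T₀ = Rᵀ := by rw [hT₀, ← Matrix.mul_assoc, mul_nonsing_inv _ hJu, Matrix.one_mul]
  have hT₀J : T₀ᵀ * J = R := by
    rw [← transpose_transpose (T₀ᵀ * J), transpose_mul, transpose_transpose, hJ, hJT₀,
      transpose_transpose]
  have hxT₀ : x * T₀ = -(T₀ * eᵀ) := by
    have : J * (x * T₀) = J * -(T₀ * eᵀ) := by
      rw [← Matrix.mul_assoc, ← neg_neg (J * x), ← hx, Matrix.neg_mul, Matrix.mul_assoc, hJT₀,
        ← transpose_mul, hRx, transpose_mul, Matrix.mul_neg, ← Matrix.mul_assoc, hJT₀]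
    have h4 := congrArg (J⁻¹ * ·) this
    simpa only [← Matrix.mul_assoc, nonsing_inv_mul _ hJu, Matrix.one_mul] using h4
  obtain ⟨D, hD⟩ : ∃ D, D = T₀ᵀ * J * T₀ := ⟨_, rfl⟩
  have hDT : Dᵀ = D := by
    rw [hD, transpose_mul, transpose_mul, transpose_transpose, hJ, Matrix.mul_assoc]
  have heD : e * D = -(D * eᵀ) := by
    calc e * D = e * R * T₀ := by rw [hD, hT₀J, Matrix.mul_assoc]
      _ = R * (x * T₀) := by rw [← hRx, Matrix.mul_assoc]
      _ = -(D * eᵀ) := by rw [hxT₀, Matrix.mul_neg, hD, hT₀J, Matrix.mul_assoc]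
  -- Subtracting half of the Gram matrix makes the dual chain isotropic.
  obtain ⟨T, hT⟩ : ∃ T, T = T₀ - (1 / 2 : k) • (S * D) := ⟨_, rfl⟩
  have hST₀ : Sᵀ * J * T₀ = 1 := by
    rw [Matrix.mul_assoc, hJT₀, ← transpose_mul, hRS, transpose_one]
  have hST : Sᵀ * J * T = 1 := by
    rw [hT, Matrix.mul_sub, Matrix.mul_smul, ← Matrix.mul_assoc, hS, hST₀]; simp
  have hTS : Tᵀ * J * S = 1 := by
    rw [← transpose_one, ← hST]
    simp only [transpose_mul, transpose_transpose, hJ, Matrix.mul_assoc]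
  have hTT : Tᵀ * J * T = 0 := by
    have h3 : Tᵀ * J = R - (1 / 2 : k) • (D * (Sᵀ * J)) := by
      rw [hT, transpose_sub, transpose_smul, transpose_mul, hDT, Matrix.sub_mul, hT₀J,
        Matrix.smul_mul, Matrix.mul_assoc]
    have h5 : R * T = (1 / 2 : k) • D := by
      rw [hT, Matrix.mul_sub, Matrix.mul_smul, ← Matrix.mul_assoc, hRS, Matrix.one_mul, ← hT₀J,
        ← hD]
      have : D = (1 / 2 : k) • D + (1 / 2 : k) • D := by
        rw [← add_smul]
        have : (1 / 2 + 1 / 2 : k) = 1 := by field_simp; norm_num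
        rw [this, one_smul]
      nth_rewrite 1 [this]
      abel
    rw [h3, Matrix.sub_mul, Matrix.smul_mul, Matrix.mul_assoc D, hST, h5, Matrix.mul_one, sub_self]
  refine ⟨fromCols S T, ?_, ?_⟩
  · rw [transpose_fromCols, fromRows_mul, fromRows_mul_fromCols, hS, hST, hTS, hTT]; rfl
  · rw [mul_fromCols, fromCols_mul_fromBlocks, hxS]
    congr 1
    · simp
    · rw [hT, Matrix.mul_sub, Matrix.mul_smul, ← Matrix.mul_assoc, hxS, hxT₀, Matrix.mul_assoc,
        heD]
      simp only [Matrix.mul_zero, Matrix.mul_neg, Matrix.sub_mul, Matrix.smul_mul,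
        Matrix.mul_assoc, smul_neg]
      abel

/-- The analogue of `exists_deformed_triples_of_stable` for symplectic (`ε = -1`) and special
orthogonal (`ε = 1`) groups. -/
theorem exists_deformed_triples_of_stable_form [IsAlgClosed k] {p : ℕ} [CharP k p] (hp : 2 < p)
    {J : Matrix ι ι k} {ε : k} (hε : ε = 1 ∨ ε = -1) (hJ : Jᵀ = ε • J) (hJu : IsUnit J.det)
    {V : Set (Matrix ι ι k)} (hV : IsZariskiClosed V)
    (hst : ∀ g g' : Matrix ι ι k, g * g' = 1 → gᵀ * J * g = J → (ε = 1 → g.det = 1) →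
      ∀ x ∈ V, g * x * g' ∈ V)
    (hnil : ∀ x ∈ V, IsNilpotent x) (hskew : ∀ x ∈ V, xᵀ * J = -(J * x))
    (h : ∃ x ∈ V, x ^ p ≠ 0) :
    ∃ x ∈ V, x ^ p ≠ 0 ∧ ∀ c : k, c ≠ 0 → ∃ h, ∃ f ∈ V, IsDeformedTriple p c x h f := by
  have : Infinite k := IsAlgClosed.instInfinite
  have h2 : (2 : k) ≠ 0 := by
    exact_mod_cast natCast_ne_zero_of_lt (k := k) p (show 0 < 2 by omega) hp
  have h11 : (1 : k) ≠ -1 := fun h => h2 (by linear_combination h)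
  have hprime : p.Prime := (CharP.char_is_prime_or_zero k p).resolve_right (by omega)
  have hodd : Odd p := hprime.odd_of_ne_two (by omega)
  obtain ⟨x, hxV, hxp, hmin⟩ := exists_minimal_rank h
  refine ⟨x, hxV, hxp, fun c hc => ?_⟩
  have hx := hskew x hxV
  obtain ⟨M, hpM, hM1, hM⟩ := exists_pow_succ_eq_zero (hnil x hxV) hxp
  have hstar := fun {u y : ι → k} => pow_mulVec_mem_span_of_minimal_form h2 (by omega : p ≠ 0) hε
    hJ hJu hV hst hxV hx hmin (u := u) (y := y)
  have himg : ∀ u : ι → k, x *ᵥ (x ^ (M - 1) *ᵥ u) = x ^ M *ᵥ u := fun u => by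
    rw [mulVec_mulVec, mul_pow_sub_one (by omega)]
  have hker : ∀ u : ι → k, x *ᵥ (x ^ M *ᵥ u) = 0 := fun u => by
    rw [mulVec_mulVec, ← pow_succ', hM1, zero_mulVec]
  -- A frame adapted to `x` with nondegenerate Gram matrix already exhausts `x`, by minimality.
  have finish : ∀ {α : Type} [Fintype α] [DecidableEq α] (S : Matrix ι α k)
      (K e h f g : Matrix α α k), IsUnit K.det → Sᵀ * J * S = K → x * S = S * e → e ^ p ≠ 0 →
      gᵀ * K * g = K → (ε = 1 → g.det = 1) → g * e = f * g → IsDeformedTriple p c e h f →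
      ∃ h, ∃ f ∈ V, IsDeformedTriple p c x h f := by
    intro α _ _ S K e h f g hK hS hxS he hg hgdet hge hT
    obtain ⟨R, hRS, hRx, h1, h3⟩ := exists_adjoint_retraction hε hJ hx hK hS hxS
    have hxe : x = S * e * R := by
      refine eq_frame_of_forall (hnil x hxV) hxS hRS hRx fun u y hy hxu hRu => ?_
      by_contra hu
      obtain ⟨z, hz⟩ := exists_mulVec_ne_zero he
      obtain ⟨c, hc⟩ := hstar hu hy hxu (S *ᵥ z) (by
        rw [mulVec_mulVec, h3, ← mulVec_mulVec, dotProduct_mulVec, vecMul_transpose, hRu,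
          zero_dotProduct])
      exact pow_mulVec_frame_ne_smul hxS hRS hz hRu c hc
    refine ⟨S * h * R, S * f * R, frameExtend_mem hRS hge (isUnit_det_of_isometry hK hg)
      (fun g' h => hst _ g' h (frameExtend_isometry hRS h1 h3 hg) fun hε1 => ?_) (hxe ▸ hxV), ?_⟩
    · rw [det_frameExtend hRS, hgdet hε1]
    · have := hT.frame hRS (by omega)
      rwa [← hxe] at this
  -- The form `(a, b) ↦ ⟨a, x ^ M b⟩` is symmetric or alternating; it is nonzero since `x ^ M` is.
  by_cases hsym : ∃ v, v ⬝ᵥ J *ᵥ (x ^ M *ᵥ v) ≠ 0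
  · -- One block: the nondegenerate chain generated by `v`.
    obtain ⟨v, hv⟩ := hsym
    have hv0 : x ^ M *ᵥ v ≠ 0 := fun h => hv (by rw [h]; simp)
    have hsign : ε * (-1) ^ M = 1 := by
      have := form_pow_symm hε hJ hx M v v
      exact (mul_right_cancel₀ hv (by rw [one_mul]; exact this)).symm
    have hMp : M ≤ p + 1 := by
      by_contra hlt
      obtain ⟨c, hc⟩ := hstar hv0 (himg v) (hker v) (x *ᵥ v) (by
        rw [pow_mulVec_form hx, mulVec_mulVec v, ← pow_succ, hM1]; simp)
      -- `x v` is orthogonal to `x ^ M v`, so `x ^ (p + 1) v` is a multiple of `x ^ M v`.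
      have h1 := congrArg (fun w => x ^ (M - (p + 1)) *ᵥ w) hc
      have h3 : M - (p + 1) + (p + 1) = M := by omega
      have h4 : M - (p + 1) + M = M + 1 + (M - (p + 2)) := by omega
      simp only [mulVec_smul, mulVec_mulVec, ← pow_add, ← pow_succ] at h1
      rw [h3, h4, pow_add, hM1, zero_mul, zero_mulVec, smul_zero] at h1
      exact hv0 h1
    have hN : (M + 1 = p + 1 ∨ M + 1 = p + 2) ∧ (ε = 1 → Odd (M + 1)) := by
      refine ⟨by omega, ?_⟩
      rintro rfl
      rw [one_mul] at hsign
      rcases Nat.even_or_odd M with he | ho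
      · exact he.add_one
      · rw [ho.neg_one_pow] at hsign
        exact absurd hsign.symm h11
    obtain ⟨u, huM, hlow⟩ := exists_orthogonal_powers h2 hε hJ hx hM1 hv
    have htop : u ⬝ᵥ J *ᵥ (x ^ M *ᵥ u) ≠ 0 := by
      rw [huM, form_pow_symm hε hJ hx, hsign, one_mul, huM]
      exact hv
    obtain ⟨α, hxS, hS⟩ := exists_frame_of_skew hx (v := u) (N := M + 1)
      (by rw [hM1, zero_mulVec]) (by simpa using hlow) (by simpa using htop)
    obtain ⟨h, f, g, hT, hg, hgdet, hge⟩ := exists_deformed_triple hp hN.1 hc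
    exact finish _ _ _ h f g (isUnit_det_antidiagForm _) hS hxS
      (jordanBlock_pow_ne_zero (by omega)) hg (fun h => hgdet (hN.2 h)) hge hT
  · -- Two blocks: the form `(a, b) ↦ ⟨a, x ^ M b⟩` is alternating.
    push Not at hsym
    obtain ⟨u, hu⟩ := exists_mulVec_ne_zero hM
    obtain ⟨v, hv⟩ : ∃ v, v ⬝ᵥ J *ᵥ (x ^ M *ᵥ u) ≠ 0 := by
      by_contra! h
      have h0 : J *ᵥ (x ^ M *ᵥ u) = 0 := by
        ext i; simpa using h (Pi.single i 1)
      refine hu ?_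
      rw [← one_mulVec (x ^ M *ᵥ u), ← nonsing_inv_mul _ hJu, ← mulVec_mulVec, h0, mulVec_zero]
    obtain rfl : M = p := by
      obtain ⟨c, hc⟩ := hstar hu (himg u) (hker u) u (by
        rw [pow_mulVec_form hx, hsym, mul_zero])
      by_contra hne
      have h1 := congrArg (fun v => x ^ (M - p) *ᵥ v) hc
      have h3 : M - p + M = M + 1 + (M - p - 1) := by omega
      simp only [mulVec_smul, mulVec_mulVec, ← pow_add] at h1
      rw [Nat.sub_add_cancel hpM, h3, pow_add, hM1, zero_mul, zero_mulVec, smul_zero] at h1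
      exact hu h1
    have hsum : u ⬝ᵥ J *ᵥ (x ^ M *ᵥ v) + v ⬝ᵥ J *ᵥ (x ^ M *ᵥ u) = 0 := by
      have := hsym (u + v)
      simpa only [mulVec_add, dotProduct_add, add_dotProduct, hsym, zero_add, add_zero,
        add_comm] using this
    obtain rfl : ε = 1 := by
      refine hε.resolve_right ?_
      rintro rfl
      rw [form_pow_symm hε hJ hx, hodd.neg_one_pow] at hsum
      refine mul_ne_zero h2 hv ?_
      linear_combination hsum
    obtain ⟨w, hwM, hlow⟩ := exists_orthogonal_powers h2 hε hJ hx hM1 hv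
    have hw : x ^ (M + 1 - 1) *ᵥ w ≠ 0 := by simpa [hwM] using hu
    obtain ⟨R, hRS, hRx⟩ := exists_retraction hM1 hw
    set S := cyclicFrame x w (M + 1) with hSdef
    have hxS : x * S = S * jordanBlock k (M + 1) := mul_cyclicFrame (by rw [hM1, zero_mulVec])
    have hall : ∀ i, w ⬝ᵥ J *ᵥ (x ^ i *ᵥ w) = 0 := by
      intro i
      rcases lt_trichotomy i M with hi | rfl | hi
      · exact hlow i hi
      · exact hsym w
      · rw [pow_eq_zero_of_le hi hM1]; simp
    have hS : Sᵀ * J * S = 0 := by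
      ext i j
      have h1 : (Sᵀ * J * S) i j =
          (x ^ (M + 1 - 1 - (i : ℕ)) *ᵥ w) ⬝ᵥ J *ᵥ (x ^ (M + 1 - 1 - (j : ℕ)) *ᵥ w) := by
        rw [Matrix.mul_assoc]; rfl
      rw [h1, pow_mulVec_form hx, mulVec_mulVec w, ← pow_add, hall, mul_zero]; rfl
    obtain ⟨S', hS', hxS'⟩ := exists_hyperbolic_frame h2 (by simpa using hJ) hJu hx hRS hxS hRx hS
    obtain ⟨h, f, g, hT, hg, -, hge⟩ := exists_deformed_triple hp (Or.inl rfl) hc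
    have hgu := isUnit_det_of_isometry (isUnit_det_antidiagForm _) hg
    have hge' : jordanBlock k (M + 1) * g⁻¹ = g⁻¹ * f := by
      have := congrArg (fun A => g⁻¹ * A * g⁻¹) hge
      simpa only [← Matrix.mul_assoc, nonsing_inv_mul _ hgu, Matrix.one_mul,
        mul_nonsing_inv_cancel_right _ _ hgu] using this
    refine finish S' _ _ _ _ (fromBlocks g 0 0 (g⁻¹)ᵀ) (isUnit_det_hyperbolicForm _) hS' hxS' ?_ ?_
      (fun _ => ?_) ?_ (hT.dualSum hodd)
    · rw [fromBlocks_diagonal_pow]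
      intro h0
      refine jordanBlock_pow_ne_zero (k := k) (show M < M + 1 by omega) ?_
      rw [← toBlocks_fromBlocks₁₁ (jordanBlock k (M + 1) ^ M) 0 0, h0]
      rfl
    · rw [hyperbolicForm, fromBlocks_transpose, fromBlocks_multiply, fromBlocks_multiply]
      simp [← transpose_mul, nonsing_inv_mul _ hgu]
    · rw [det_fromBlocks_zero₂₁, det_transpose, det_nonsing_inv, Ring.mul_inverse_cancel _ hgu]
    · rw [fromBlocks_multiply, fromBlocks_multiply]
      simp [hge, ← transpose_mul, hge']

end IsometryGroups

/-! ### Consequences for the orbit map -/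

section Sl2Property

attribute [local instance 100] LieRing.ofAssociativeRing

variable {k : Type*} [Field k] {ι : Type*} [Fintype ι] [DecidableEq ι]

/-- The parameters `1` and `-1` give two triples with the same first member that are not conjugate,
which contradicts injectivity of the map on orbits. -/
theorem not_hasSl2Property_of_deformed_triples (h2 : (2 : k) ≠ 0) {p : ℕ}
    {G : Subgroup (GL ι k)} {𝔤 : LieSubalgebra k (Matrix ι ι k)} {V : Set (Matrix ι ι k)}
    (hV : V ⊆ nilpotentCone 𝔤)
    (h : ∃ x ∈ V, x ^ p ≠ 0 ∧ ∀ c : k, c ≠ 0 → ∃ h, ∃ f ∈ V, IsDeformedTriple p c x h f) :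
    ¬ HasSl2Property G 𝔤 V := by
  rintro ⟨-, hinj, -⟩
  obtain ⟨e, heV, hep, H⟩ := h
  have htriple : ∀ {c h f}, f ∈ V → IsDeformedTriple p c e h f →
      tripleOrbit G (e, h, f) ∈ tripleOrbits G 𝔤 V := by
    intro c h f hf hT
    have he := (hV heV).1
    have hf' := (hV hf).1
    refine ⟨(e, h, f), ⟨⟨he, ?_, hf'⟩, hT.weight_raising, hT.weight_lowering,
      hT.raising_lowering⟩, heV, hf, rfl⟩
    rw [← hT.raising_lowering]
    exact 𝔤.lie_mem he hf'
  obtain ⟨h₁, f₁, hf₁, H₁⟩ := H 1 one_ne_zero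
  obtain ⟨h₂, f₂, hf₂, H₂⟩ := H (-1) (neg_ne_zero.2 one_ne_zero)
  have heq : tripleOrbit G (e, h₁, f₁) = tripleOrbit G (e, h₂, f₂) :=
    hinj (htriple hf₁ H₁) (htriple hf₂ H₂) (by simp only [fst_image_tripleOrbit])
  have hmem : (e, h₁, f₁) ∈ tripleOrbit G (e, h₂, f₂) := by
    rw [← heq]
    exact ⟨1, G.one_mem, by simp [Ad]⟩
  obtain ⟨g, -, hg⟩ := hmem
  simp only [Prod.mk.injEq] at hg
  obtain ⟨hge, hgh, -⟩ := hg
  have hpow : ∀ (y : Matrix ι ι k) (n : ℕ), Ad g y ^ n = Ad g (y ^ n) := fun y n =>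
    Units.conj_pow g y n
  -- Conjugation by `g` fixes `e` and moves `h₂ - h₂ ^ p = -e ^ p` to `h₁ - h₁ ^ p = e ^ p`.
  have h1 : e ^ p = -e ^ p := by
    calc e ^ p = h₁ - h₁ ^ p := by rw [H₁.sub_pow, one_smul]
      _ = Ad g (h₂ - h₂ ^ p) := by
        rw [hgh, hpow]
        simp only [Ad, mul_sub, sub_mul]
      _ = -Ad g (e ^ p) := by rw [H₂.sub_pow, neg_one_smul]; simp [Ad]
      _ = -e ^ p := by rw [← hpow, ← hge]
  refine hep ((smul_eq_zero.1 (?_ : (2 : k) • e ^ p = 0)).resolve_left h2)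
  rw [two_smul]
  nth_rewrite 2 [h1]
  exact add_neg_cancel _

theorem subset_restrictedNilpotentCone_of_deformed_triples (h2 : (2 : k) ≠ 0) {p : ℕ}
    {G : Subgroup (GL ι k)} {𝔤 : LieSubalgebra k (Matrix ι ι k)} {V : Set (Matrix ι ι k)}
    (hV : V ⊆ nilpotentCone 𝔤) (hsl : HasSl2Property G 𝔤 V)
    (h : (∃ x ∈ V, x ^ p ≠ 0) →
      ∃ x ∈ V, x ^ p ≠ 0 ∧ ∀ c : k, c ≠ 0 → ∃ h, ∃ f ∈ V, IsDeformedTriple p c x h f) :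
    V ⊆ restrictedNilpotentCone 𝔤 p := by
  intro x hx
  refine ⟨(hV hx).1, ?_⟩
  by_contra hxp
  exact not_hasSl2Property_of_deformed_triples h2 hV (h ⟨x, hx, hxp⟩) hsl

theorem mul_mul_mem_of_stable {G : Subgroup (GL ι k)} {𝔤 : LieSubalgebra k (Matrix ι ι k)}
    {V : Set (Matrix ι ι k)} (hV : IsStableClosedSubvariety G 𝔤 V) {g g' : Matrix ι ι k}
    (h : g * g' = 1) (hg : ∀ γ : GL ι k, (γ : Matrix ι ι k) = g → γ ∈ G) {x : Matrix ι ι k}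
    (hx : x ∈ V) : g * x * g' ∈ V :=
  hV.stable ⟨g, g', h, mul_eq_one_comm.1 h⟩ (hg _ rfl) x hx

/-- Over an algebraically closed field every invertible matrix is a scalar multiple of one of
determinant one, so `SL`-stable sets are stable under all conjugations. -/
theorem mul_mul_mem_of_stable_SL [IsAlgClosed k] {𝔤 : LieSubalgebra k (Matrix ι ι k)}
    {V : Set (Matrix ι ι k)} (hV : IsStableClosedSubvariety (SLgroup ι k) 𝔤 V)
    {g g' : Matrix ι ι k} (h : g * g' = 1) {x : Matrix ι ι k} (hx : x ∈ V) :
    g * x * g' ∈ V := by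
  rcases isEmpty_or_nonempty ι with hι | hι
  · rwa [Subsingleton.elim (g * x * g') x]
  have hdet : g.det ≠ 0 := by
    intro h0
    have := congrArg det h
    rw [det_mul, h0, zero_mul, det_one] at this
    exact zero_ne_one this
  obtain ⟨a, ha⟩ := IsAlgClosed.exists_pow_nat_eq g.det⁻¹ (n := Fintype.card ι) Fintype.card_pos
  have ha0 : a ≠ 0 := by
    rintro rfl
    rw [zero_pow Fintype.card_ne_zero] at ha
    exact inv_ne_zero hdet ha.symm
  have h1 : (a • g) * (a⁻¹ • g') = 1 := by
    rw [smul_mul_smul_comm, mul_inv_cancel₀ ha0, one_smul, h]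
  have := mul_mul_mem_of_stable hV h1 (fun γ hγ => by
    rw [mem_SLgroup_iff, hγ, det_smul, ha, inv_mul_cancel₀ hdet]) hx
  rwa [smul_mul_assoc, smul_mul_assoc, mul_smul_comm, smul_smul, mul_inv_cancel₀ ha0,
    one_smul] at this

/-- The orthogonal case, for any group between `SO` and `O`. -/
theorem subset_restrictedNilpotentCone_so [IsAlgClosed k] {p : ℕ} [CharP k p] (hp : 2 < p)
    {G : Subgroup (GL ι k)} (hG : SOgroup ι k ≤ G) {V : Set (Matrix ι ι k)}
    (hV : IsStableClosedSubvariety G (LieAlgebra.Orthogonal.so ι k) V)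
    (hsl : HasSl2Property G (LieAlgebra.Orthogonal.so ι k) V) :
    V ⊆ restrictedNilpotentCone (LieAlgebra.Orthogonal.so ι k) p := by
  have h2 : (2 : k) ≠ 0 := by
    exact_mod_cast natCast_ne_zero_of_lt (k := k) p (show 0 < 2 by omega) hp
  refine subset_restrictedNilpotentCone_of_deformed_triples h2 hV.subset_nilpotentCone hsl
    (exists_deformed_triples_of_stable_form hp (J := 1) (Or.inl rfl) (by simp) (by simp) hV.closed
      (fun g g' h hg hdet x hx => mul_mul_mem_of_stable hV h
        (fun γ hγ => hG (Subgroup.mem_inf.2 ⟨?_, ?_⟩)) hx)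
      (fun x hx => (hV.subset_nilpotentCone hx).2) fun x hx => ?_)
  · rw [mem_Ogroup_iff, hγ]
    simpa using hg
  · rw [mem_SLgroup_iff, hγ]
    exact hdet rfl
  · simpa using (LieAlgebra.Orthogonal.mem_so _ _ x).1 (hV.subset_nilpotentCone hx).1

theorem subset_restrictedNilpotentCone_sp [IsAlgClosed k] {p : ℕ} [CharP k p] (hp : 2 < p)
    {V : Set (Matrix (ι ⊕ ι) (ι ⊕ ι) k)}
    (hV : IsStableClosedSubvariety (Spgroup ι k) (LieAlgebra.Symplectic.sp ι k) V)
    (hsl : HasSl2Property (Spgroup ι k) (LieAlgebra.Symplectic.sp ι k) V) :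
    V ⊆ restrictedNilpotentCone (LieAlgebra.Symplectic.sp ι k) p := by
  have h2 : (2 : k) ≠ 0 := by
    exact_mod_cast natCast_ne_zero_of_lt (k := k) p (show 0 < 2 by omega) hp
  refine subset_restrictedNilpotentCone_of_deformed_triples h2 hV.subset_nilpotentCone hsl
    (exists_deformed_triples_of_stable_form hp (J := J ι k) (Or.inr rfl)
      (by rw [J_transpose, neg_one_smul]) (isUnit_det_J ι k) hV.closed
      (fun g g' h hg _ x hx => mul_mul_mem_of_stable hV h (fun γ hγ => ?_) hx)
      (fun x hx => (hV.subset_nilpotentCone hx).2) fun x hx => ?_)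
  · rw [mem_Spgroup_iff, hγ, ← SymplecticGroup.mem_iff, SymplecticGroup.mem_iff']
    exact hg
  · have := (hV.subset_nilpotentCone hx).1
    rw [LieAlgebra.Symplectic.sp, mem_skewAdjointMatricesLieSubalgebra,
      mem_skewAdjointMatricesSubmodule] at this
    have h3 : xᵀ * J ι k = J ι k * -x := this
    rw [h3, Matrix.mul_neg]

end Sl2Property

end ClassicalSl2

/-- The five conjuncts are the cases `GL_n`, `SL_n`, `Sp_n` (with `n = 2 * m`), `O_n`, `SO_n`. -/
theorem proposition2p2 (k : Type*) [Field k] [IsAlgClosed k] (p : ℕ) [CharP k p] (hp : 2 < p) :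
    (∀ (n : ℕ) (V : Set (Matrix (Fin n) (Fin n) k)),
      ClassicalSl2.IsStableClosedSubvariety ⊤ ⊤ V →
      ClassicalSl2.HasSl2Property ⊤ ⊤ V →
      V ⊆ ClassicalSl2.restrictedNilpotentCone ⊤ p) ∧
    (∀ (n : ℕ) (V : Set (Matrix (Fin n) (Fin n) k)),
      ClassicalSl2.IsStableClosedSubvariety
        (ClassicalSl2.SLgroup (Fin n) k) (LieAlgebra.SpecialLinear.sl (Fin n) k) V →
      ClassicalSl2.HasSl2Property
        (ClassicalSl2.SLgroup (Fin n) k) (LieAlgebra.SpecialLinear.sl (Fin n) k) V →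
      V ⊆ ClassicalSl2.restrictedNilpotentCone (LieAlgebra.SpecialLinear.sl (Fin n) k) p) ∧
    (∀ (m : ℕ) (V : Set (Matrix (Fin m ⊕ Fin m) (Fin m ⊕ Fin m) k)),
      ClassicalSl2.IsStableClosedSubvariety
        (ClassicalSl2.Spgroup (Fin m) k) (LieAlgebra.Symplectic.sp (Fin m) k) V →
      ClassicalSl2.HasSl2Property
        (ClassicalSl2.Spgroup (Fin m) k) (LieAlgebra.Symplectic.sp (Fin m) k) V →
      V ⊆ ClassicalSl2.restrictedNilpotentCone (LieAlgebra.Symplectic.sp (Fin m) k) p) ∧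
    (∀ (n : ℕ) (V : Set (Matrix (Fin n) (Fin n) k)),
      ClassicalSl2.IsStableClosedSubvariety
        (ClassicalSl2.Ogroup (Fin n) k) (LieAlgebra.Orthogonal.so (Fin n) k) V →
      ClassicalSl2.HasSl2Property
        (ClassicalSl2.Ogroup (Fin n) k) (LieAlgebra.Orthogonal.so (Fin n) k) V →
      V ⊆ ClassicalSl2.restrictedNilpotentCone (LieAlgebra.Orthogonal.so (Fin n) k) p) ∧
    (∀ (n : ℕ) (V : Set (Matrix (Fin n) (Fin n) k)),
      ClassicalSl2.IsStableClosedSubvariety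
        (ClassicalSl2.SOgroup (Fin n) k) (LieAlgebra.Orthogonal.so (Fin n) k) V →
      ClassicalSl2.HasSl2Property
        (ClassicalSl2.SOgroup (Fin n) k) (LieAlgebra.Orthogonal.so (Fin n) k) V →
      V ⊆ ClassicalSl2.restrictedNilpotentCone (LieAlgebra.Orthogonal.so (Fin n) k) p) := by
  have h2 : (2 : k) ≠ 0 := by
    exact_mod_cast ClassicalSl2.natCast_ne_zero_of_lt (k := k) p (show 0 < 2 by omega) hp
  refine ⟨fun n V hV hsl => ?_, fun n V hV hsl => ?_, fun m V hV hsl => ?_, fun n V hV hsl => ?_,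
    fun n V hV hsl => ?_⟩
  · exact ClassicalSl2.subset_restrictedNilpotentCone_of_deformed_triples h2
      hV.subset_nilpotentCone hsl (ClassicalSl2.exists_deformed_triples_of_stable hp hV.closed
        (fun g g' h x hx => ClassicalSl2.mul_mul_mem_of_stable hV h
          (fun _ _ => Subgroup.mem_top _) hx)
        fun x hx => (hV.subset_nilpotentCone hx).2)
  · exact ClassicalSl2.subset_restrictedNilpotentCone_of_deformed_triples h2
      hV.subset_nilpotentCone hsl (ClassicalSl2.exists_deformed_triples_of_stable hp hV.closed
        (fun g g' h x hx => ClassicalSl2.mul_mul_mem_of_stable_SL hV h hx)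
        fun x hx => (hV.subset_nilpotentCone hx).2)
  · exact ClassicalSl2.subset_restrictedNilpotentCone_sp hp hV hsl
  · exact ClassicalSl2.subset_restrictedNilpotentCone_so hp inf_le_left hV hsl
  · exact ClassicalSl2.subset_restrictedNilpotentCone_so hp le_rfl hV hsl
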